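/- \textbf{Theorem (Iteration Count Bound).} \emph{Framework.} There are $M$ types, $J$ firms, $T$ periods, a finite state space $\mathcal X$ and a finite action space $\mathcal A$. Structural parameters lie in $\Theta\subseteq\mathbb R^{d}$, nuisance parameters in $\mathcal Y\subseteq\mathbb R^{n}$, choice-probability profiles $P=(P_j(a|x))$ in $\mathcal P\subseteq\mathbb R^{J|\mathcal X||\mathcal A|}$. Let $G(\theta,\tilde\theta,Y,P)$ be the mapping of the fixed-point equation $Y=G(\theta,\tilde\theta,Y,P)$, $\Gamma^q(\theta,\tilde\theta,P;Y)$ the result of $q$ steps of an inner algorithm applied to the map $y\mapsto G(\theta,\tilde\theta,y,P)$ from the initial guess $Y$ ($q=\infty$: run until convergence), $\Lambda_j(\theta,Y,P)(a|x)$ a logit choice-probability mapping, and $\Lambda^q(\theta,\tilde\theta,Y,P)=\Lambda(\theta,\Gamma^q(\theta,\tilde\theta,P;Y),P)$. Bold letters are vectors stacked over types $m=1,\dots,M$, and mappings act on them type by type. For a sample of $N$ markets, an EM-NPL($q$) fixed point is $(\boldsymbol\pi,\boldsymbol\theta,\mathbf Y,\mathbf P)$ with components in $\Delta^{M-1},\Theta^M,\mathcal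 Y^M,\mathcal P^M$ such that $(\boldsymbol\theta,\boldsymbol\pi)$ maximizes $(\boldsymbol\vartheta,\boldsymbol\varpi)\mapsto\frac1N\sum_i\log\sum_m\varpi_m\prod_{t,j}\Lambda^q_j(\vartheta^m,\theta^m,Y^m,P^m)(a_{jit}|x_{it})$ over $\Theta^M\times\Delta^{M-1}$, $\mathbf Y=\Gamma^q(\boldsymbol\theta,\boldsymbol\theta,\mathbf P;\mathbf Y)$ and $\mathbf P=\Lambda(\boldsymbol\theta,\mathbf Y,\mathbf P)$; an EM-NPL($q$) estimator is a fixed point at which this objective, evaluated at $(\boldsymbol\theta,\boldsymbol\pi)$, is largest among all fixed points. EM-NPL means $q=\infty$. \emph{Truth.} Let $(\boldsymbol\pi^*,\boldsymbol\theta^*,\mathbf Y^*,\mathbf P^*)$ satisfy $\pi^*_m>0$, $\sum_m\pi_m^*=1$, $\theta^{m*}\in\operatorname{int}\Theta$, $Y^{m*}\in\operatorname{int}\mathcal Y$, $P^{m*}\in\operatorname{int}\mathcal P$, $Y^{m*}=G(\theta^{m*},\theta^{m*},Y^{m*},P^{m*})$, $P^{m*}=\Lambda(\theta^{m*},Y^{m*},P^{m*})$.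 A market has type $m$ with probability $\pi^*_m$; given the type its observations $(x_t,(a_{jt})_j)_{t=1}^T$ form a stationary Markov process in which the firms choose independently with probabilities $P^{m*}_j(\cdot|x_t)$, the state moves by a transition probability common to all types, and every state has positive probability. $\mathbb E$ is the expectation under this law. \emph{Rate matrix.} Put $w_m(\mathbf P,\boldsymbol\pi)=\dfrac{\pi_m\prod_{t,j}P^m_j(a_{jt}|x_t)}{\sum_{m'}\pi_{m'}\prod_{t,j}P^{m'}_j(a_{jt}|x_t)}$, $E(\boldsymbol\pi,\mathbf P)=(\mathbb E\,w_m(\mathbf P,\boldsymbol\pi))_m$ and $\ell_E^q(\boldsymbol\theta;\tilde{\boldsymbol\theta},\mathbf Y,\mathbf P,\boldsymbol\pi)=\sum_m\mathbb E\big[w_m(\mathbf P,\boldsymbol\pi)\sum_{t,j}\log\Lambda^q_j(\theta^m,\tilde\theta^m,Y^m,P^m)(a_{jt}|x_t)\big]$. Let subscripts denote Jacobians at the truth (with $\tilde{\boldsymbol\theta}=\boldsymbol\theta^*$), and $H^q_z=-(\nabla^2_{\boldsymbol\theta\boldsymbol\theta}\ell_E^q)^{-1}\nabla^2_{\boldsymbol\theta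 z}\ell^q_E$ for $z\in\{\boldsymbol\pi,\tilde{\boldsymbol\theta},\mathbf Y,\mathbf P\}$. In the order $(\boldsymbol\pi,\boldsymbol\theta,\mathbf Y,\mathbf P)$ let $$R^q=\begin{pmatrix}E_{\boldsymbol\pi}&0&0&E_{\mathbf P}\\ H^q_{\boldsymbol\pi}&H^q_{\tilde{\boldsymbol\theta}}&H^q_{\mathbf Y}&H^q_{\mathbf P}\\ \Gamma^q_{\boldsymbol\theta}H^q_{\boldsymbol\pi}&\Gamma^q_{\boldsymbol\theta}H^q_{\tilde{\boldsymbol\theta}}+\Gamma^q_{\tilde{\boldsymbol\theta}}&\Gamma^q_{\boldsymbol\theta}H^q_{\mathbf Y}+\Gamma^q_{\mathbf Y}&\Gamma^q_{\boldsymbol\theta}H^q_{\mathbf P}+\Gamma^q_{\mathbf P}\\ \Lambda^q_{\boldsymbol\theta}H^q_{\boldsymbol\pi}&\Lambda^q_{\boldsymbol\theta}H^q_{\tilde{\boldsymbol\theta}}+\Lambda^q_{\tilde{\boldsymbol\theta}}&\Lambda^q_{\boldsymbol\theta}H^q_{\mathbf Y}+\Lambda^q_{\mathbf Y}&\Lambda^q_{\boldsymbol\theta}H^q_{\mathbf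 P}+\Lambda^q_{\mathbf P}\end{pmatrix}.$$ \emph{Assumptions.} (a) ($\theta$-separability) $G$ does not depend on its first argument $\theta$. (b) For all $\theta,\tilde\theta\in\Theta$, $P\in\mathcal P$ the equation $Y=G(\theta,\tilde\theta,Y,P)$ has a unique solution $Y(\theta,\tilde\theta,P)\in\mathcal Y$; for every $q\ge1$ it is also the only fixed point of $\Gamma^q(\theta,\tilde\theta,P;\cdot)$ in $\mathcal Y$; and $\Gamma^\infty(\theta,\tilde\theta,P;Y_0)$ equals it for every initial guess $Y_0\in\mathcal Y$. (c) For every $1\le q\le\infty$ and every $m$, $\Gamma^q$ and $\Lambda$ are thrice continuously differentiable around the truth and $\nabla^2_{\boldsymbol\theta\boldsymbol\theta}\ell^q_E$ is nonsingular there. (d) $f(q)\ge0$, $f(q)\to0$ as $q\to\infty$, and $\|Y(\theta,\tilde\theta,P)-\Gamma^q(\theta,\tilde\theta,P;Y)\|_2\le\|Y(\theta,\tilde\theta,P)-Y\|_2\,f(q)$ for all $q\ge1$ and all $(\theta,\tilde\theta,P,Y)$ in a neighborhood of $(\theta^{m*},\theta^{m*},P^{m*},Y^{m*})$, for every $m$.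 \emph{Conclusion.} For every $q\ge1$ and every sample, the EM-NPL($q$) estimators are exactly the EM-NPL estimators. Let $\rho$ denote the spectral radius and $\nu$ the size of the largest Jordan block of $R^\infty$. There is a constant $C>0$ such that, with $g(q):=C f(q)^{1/\nu}$, $$|\rho(R^q)-\rho(R^\infty)|\le g(q)\qquad\text{for all sufficiently large }q.$$ If moreover $\rho(R^\infty)\in(0,1)$, then for all sufficiently large $q$ one has $\rho(R^q)\in(0,1)$, $0<\rho(R^\infty)-g(q)$, $\rho(R^\infty)+g(q)<1$, and for every sample, every EM-NPL estimator $x_*$, every initial guess $x_0$ and every $0<\varepsilon<\|x_0-x_*\|_2$, the iteration bounds $\bar K_q:=\dfrac{\log\varepsilon-\log\|x_0-x_*\|_2}{\log\rho(R^q)}$ $(1\le q\le\infty)$ satisfy $$\bar K_q\in\left[\bar K_\infty\cdot\frac{\log\rho(R^\infty)}{\log(\rho(R^\infty)-g(q))},\ \bar K_\infty\cdot\frac{\log\rho(R^\infty)}{\log(\rho(R^\infty)+g(q))}\right].$$ -/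

import Mathlib

open Filter Topology

namespace EMNPL

section Linear

variable {ι κ : Type*} [Fintype ι] [Fintype κ] [DecidableEq ι] [DecidableEq κ]

/-- Euclidean norm of a real vector. (The sup norm that a function space carries in Mathlib is
used only for its topology and for derivatives, which do not depend on the choice of norm.) -/
noncomputable def l2norm (v : ι → ℝ) : ℝ := Real.sqrt (∑ i, v i ^ 2)

/-- Jacobian matrix of `f` at `z`. -/
noncomputable def jacobian (f : (κ → ℝ) → (ι → ℝ)) (z : κ → ℝ) : Matrix ι κ ℝ :=
  LinearMap.toMatrix' (fderiv ℝ f z : (κ → ℝ) →ₗ[ℝ] (ι → ℝ))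

/-- Gradient (vector of partial derivatives) of `f` at `z`. -/
noncomputable def grad (f : (κ → ℝ) → ℝ) (z : κ → ℝ) : κ → ℝ :=
  fun k => fderiv ℝ f z (Pi.single k 1)

/-- A real square matrix seen as a complex matrix. -/
noncomputable def complexify (R : Matrix ι ι ℝ) : Matrix ι ι ℂ := R.map Complex.ofReal

/-- Spectral radius of a real matrix: the largest modulus of a complex eigenvalue. -/
noncomputable def specRadius (R : Matrix ι ι ℝ) : ℝ :=
  (spectralRadius ℂ (complexify R)).toReal

/-- `ν_μ`: the size of the largest Jordan block of `R` for the complex eigenvalue `μ`, i.e. the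
length of the longest Jordan chain at `μ`: the index from which on the kernels of the powers
of `R - μ` no longer grow. -/
noncomputable def jordanIndex (R : Matrix ι ι ℝ) (μ : ℂ) : ℕ :=
  Module.End.maxGenEigenspaceIndex (Matrix.toLin' (complexify R)) μ

/-- `ν = max_{μ ∈ spec R} ν_μ`: the size of the largest Jordan block of `R`. -/
noncomputable def largestJordanBlock (R : Matrix ι ι ℝ) : ℕ :=
  sSup (jordanIndex R '' spectrum ℂ (complexify R))

end Linear

/-- Coordinates `(j, x, a)` of a profile `P_j(a|x)` of conditional choice probabilities. -/
abbrev CcpIdx (J : ℕ) (X A : Type*) := Fin J × X × A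

/-- The observations `(x_t, (a_{jt})_j)`, `t = 1, …, T`, of one market. -/
abbrev Panel (T J : ℕ) (X A : Type*) := Fin T → X × (Fin J → A)

/-- The type-`m` component of a vector that is stacked over types. -/
def slice {M : ℕ} {ι : Type*} (z : Fin M × ι → ℝ) (m : Fin M) : ι → ℝ := fun i => z (m, i)

/-- Coordinates of the stacked vector `(π, θ, Y, P)`. -/
abbrev StateIdx (d n J M : ℕ) (X A : Type*) :=
  Fin M ⊕ (Fin M × Fin d) ⊕ (Fin M × Fin n) ⊕ (Fin M × CcpIdx J X A)

instance {d n J M : ℕ} {X A : Type*} [DecidableEq X] [DecidableEq A] :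
    DecidableEq (StateIdx d n J M X A) :=
  @instDecidableEqSum _ _ inferInstance (@instDecidableEqSum _ _ inferInstance
    (@instDecidableEqSum _ _ inferInstance inferInstance))

/-- A point `(π, θ, Y, P)`, stacked over the `M` types. -/
structure State (d n J M : ℕ) (X A : Type*) where
  π : Fin M → ℝ
  θ : Fin M × Fin d → ℝ
  Y : Fin M × Fin n → ℝ
  P : Fin M × CcpIdx J X A → ℝ

/-- The point `(π, θ, Y, P)` as one vector. -/
def State.vec {d n J M : ℕ} {X A : Type*} (s : State d n J M X A) :
    StateIdx d n J M X A → ℝ :=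
  Sum.elim s.π (Sum.elim s.θ (Sum.elim s.Y s.P))

/-- The data of the estimation framework with `M` types, `J` firms, `T` periods, state space `X`
and action space `A`.
* `Θ`, `YY`, `PP`: the sets in which structural parameters, nuisance parameters and profiles of
  choice probabilities range;
* `G θ θ' Y P`: the mapping of the fixed-point equation `Y = G(θ, θ', Y, P)`, with `θ` the current
  and `θ'` the previous structural parameter;
* `alg q g Y`: the result of `q` steps of the inner algorithm for the equation `y = g y` started
  at `Y` (`q = ⊤`: run until convergence);
* `value θ Y P (j, x, a)`: the conditional value of firm `j` that enters the logit formula;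
* `initDist m`: distribution of the first observed state for a market of type `m`;
* `trans x a x'`: transition probability of the state. -/
structure Framework (d n J M T : ℕ) (X A : Type*) where
  Θ : Set (Fin d → ℝ)
  YY : Set (Fin n → ℝ)
  PP : Set (CcpIdx J X A → ℝ)
  G : (Fin d → ℝ) → (Fin d → ℝ) → (Fin n → ℝ) → (CcpIdx J X A → ℝ) → (Fin n → ℝ)
  alg : ℕ∞ → ((Fin n → ℝ) → (Fin n → ℝ)) → (Fin n → ℝ) → (Fin n → ℝ)
  value : (Fin d → ℝ) → (Fin n → ℝ) → (CcpIdx J X A → ℝ) → CcpIdx J X A → ℝ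
  initDist : Fin M → X → ℝ
  trans : X → (Fin J → A) → X → ℝ

namespace Framework

variable {d n J M T : ℕ} {X A : Type*} [Fintype X] [Fintype A] [DecidableEq X] [DecidableEq A]

/-- `Γ^q(θ, θ', P; Y)`: `q` steps of the inner algorithm for `Y = G(θ, θ', Y, P)` from `Y`. -/
def Γ (F : Framework d n J M T X A) (q : ℕ∞) (θ θ' : Fin d → ℝ) (P : CcpIdx J X A → ℝ)
    (Y : Fin n → ℝ) : Fin n → ℝ :=
  F.alg q (fun y => F.G θ θ' y P) Y

/-- The logit mapping `Λ_j(θ, Y, P)(a|x)`. -/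
noncomputable def Λ (F : Framework d n J M T X A) (θ : Fin d → ℝ) (Y : Fin n → ℝ)
    (P : CcpIdx J X A → ℝ) : CcpIdx J X A → ℝ :=
  fun i => Real.exp (F.value θ Y P i) / ∑ a, Real.exp (F.value θ Y P (i.1, i.2.1, a))

/-- The exact solution `Y(θ, θ', P)` of `Y = G(θ, θ', Y, P)`. -/
noncomputable def exactSol (F : Framework d n J M T X A) (θ θ' : Fin d → ℝ)
    (P : CcpIdx J X A → ℝ) : Fin n → ℝ :=
  Classical.epsilon fun Y => Y ∈ F.YY ∧ F.G θ θ' Y P = Y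

/-- `Γ^q`, type by type. -/
def stackedΓ (F : Framework d n J M T X A) (q : ℕ∞) (θ θ' : Fin M × Fin d → ℝ)
    (Y : Fin M × Fin n → ℝ) (P : Fin M × CcpIdx J X A → ℝ) : Fin M × Fin n → ℝ :=
  fun k => F.Γ q (slice θ k.1) (slice θ' k.1) (slice P k.1) (slice Y k.1) k.2

/-- `Λ`, type by type. -/
noncomputable def stackedΛ (F : Framework d n J M T X A) (θ : Fin M × Fin d → ℝ)
    (Y : Fin M × Fin n → ℝ) (P : Fin M × CcpIdx J X A → ℝ) : Fin M × CcpIdx J X A → ℝ :=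
  fun k => F.Λ (slice θ k.1) (slice Y k.1) (slice P k.1) k.2

/-- `Λ^q(θ, θ', Y, P) = Λ(θ, Γ^q(θ, θ', P; Y), P)`, type by type. -/
noncomputable def stackedΛq (F : Framework d n J M T X A) (q : ℕ∞) (θ θ' : Fin M × Fin d → ℝ)
    (Y : Fin M × Fin n → ℝ) (P : Fin M × CcpIdx J X A → ℝ) : Fin M × CcpIdx J X A → ℝ :=
  F.stackedΛ θ (F.stackedΓ q θ θ' Y P) P

/-! ### Sample objects -/

/-- The pseudo-likelihood `Q_N^q(θ, π; θ', Y, P)` of the sample `data` of `N` markets. -/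
noncomputable def pseudoLik (F : Framework d n J M T X A) (q : ℕ∞) {N : ℕ}
    (data : Fin N → Panel T J X A) (θ : Fin M × Fin d → ℝ) (π : Fin M → ℝ)
    (θ' : Fin M × Fin d → ℝ) (Y : Fin M × Fin n → ℝ) (P : Fin M × CcpIdx J X A → ℝ) : ℝ :=
  (1 / (N : ℝ)) * ∑ i, Real.log (∑ m, π m * ∏ t, ∏ j,
    F.stackedΛq q θ θ' Y P (m, (j, (data i t).1, (data i t).2 j)))

/-- `s` is an EM-NPL(`q`) fixed point of the sample. -/
structure IsFixedPoint (F : Framework d n J M T X A) (q : ℕ∞) {N : ℕ}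
    (data : Fin N → Panel T J X A) (s : State d n J M X A) : Prop where
  mem_Θ : ∀ m, slice s.θ m ∈ F.Θ
  mem_simplex : s.π ∈ stdSimplex ℝ (Fin M)
  mem_YY : ∀ m, slice s.Y m ∈ F.YY
  mem_PP : ∀ m, slice s.P m ∈ F.PP
  argmax : ∀ (ϑ : Fin M × Fin d → ℝ) (ϖ : Fin M → ℝ), (∀ m, slice ϑ m ∈ F.Θ) →
    ϖ ∈ stdSimplex ℝ (Fin M) →
    F.pseudoLik q data ϑ ϖ s.θ s.Y s.P ≤ F.pseudoLik q data s.θ s.π s.θ s.Y s.P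
  fixed_Y : s.Y = F.stackedΓ q s.θ s.θ s.Y s.P
  fixed_P : s.P = F.stackedΛ s.θ s.Y s.P

/-- `s` is an EM-NPL(`q`) estimator: a fixed point with the largest pseudo-likelihood. -/
def IsEstimator (F : Framework d n J M T X A) (q : ℕ∞) {N : ℕ}
    (data : Fin N → Panel T J X A) (s : State d n J M X A) : Prop :=
  F.IsFixedPoint q data s ∧ ∀ s', F.IsFixedPoint q data s' →
    F.pseudoLik q data s'.θ s'.π s'.θ s'.Y s'.P ≤ F.pseudoLik q data s.θ s.π s.θ s.Y s.P

/-! ### Population objects -/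

/-- Posterior probability `w_m(P, π)` of type `m` given the observations `ω`. -/
noncomputable def posterior (ω : Panel T J X A) (m : Fin M) (P : Fin M × CcpIdx J X A → ℝ)
    (π : Fin M → ℝ) : ℝ :=
  (π m * ∏ t, ∏ j, P (m, (j, (ω t).1, (ω t).2 j))) /
    ∑ m', π m' * ∏ t, ∏ j, P (m', (j, (ω t).1, (ω t).2 j))

/-- Probability of the observations `ω` of a market when `s` is the truth: the type is drawn from
`π`, and given type `m` the states start from `initDist m` and move by `trans`, while the firms
choose independently with probabilities `P_j^m(a|x)`. -/
noncomputable def law (F : Framework d n J M T X A) (s : State d n J M X A)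
    (ω : Panel T J X A) : ℝ :=
  ∑ m, s.π m * ∏ t : Fin T,
    ((if (t : ℕ) = 0 then F.initDist m (ω t).1
      else F.trans (ω ⟨t - 1, by omega⟩).1 (ω ⟨t - 1, by omega⟩).2 (ω t).1) *
    ∏ j, s.P (m, (j, (ω t).1, (ω t).2 j)))

/-- The population E-step mapping `E(π, P)` when `s` is the truth. -/
noncomputable def eStep (F : Framework d n J M T X A) (s : State d n J M X A) (π : Fin M → ℝ)
    (P : Fin M × CcpIdx J X A → ℝ) : Fin M → ℝ :=
  fun m => ∑ ω, F.law s ω * posterior ω m P π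

/-- The population M-step criterion `ℓ_E^q(θ; θ', Y, P, π)` when `s` is the truth. -/
noncomputable def mCrit (F : Framework d n J M T X A) (s : State d n J M X A) (q : ℕ∞)
    (θ θ' : Fin M × Fin d → ℝ) (Y : Fin M × Fin n → ℝ) (P : Fin M × CcpIdx J X A → ℝ)
    (π : Fin M → ℝ) : ℝ :=
  ∑ m, ∑ ω, F.law s ω * (posterior ω m P π *
    ∑ t, ∑ j, Real.log (F.stackedΛq q θ θ' Y P (m, (j, (ω t).1, (ω t).2 j))))

/-- `∇_θ ℓ_E^q(θ; θ', Y, P, π)`. -/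
noncomputable def mScore (F : Framework d n J M T X A) (s : State d n J M X A) (q : ℕ∞)
    (θ θ' : Fin M × Fin d → ℝ) (Y : Fin M × Fin n → ℝ) (P : Fin M × CcpIdx J X A → ℝ)
    (π : Fin M → ℝ) : Fin M × Fin d → ℝ :=
  grad (fun ϑ => F.mCrit s q ϑ θ' Y P π) θ

/-- The M-step Hessian `∇²_{θθ} ℓ_E^q` at the truth. -/
noncomputable def mHess (F : Framework d n J M T X A) (s : State d n J M X A) (q : ℕ∞) :
    Matrix (Fin M × Fin d) (Fin M × Fin d) ℝ :=
  jacobian (fun θ => F.mScore s q θ s.θ s.Y s.P s.π) s.θ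

/-- The M-step sensitivity `H_π^q = -(∇²_{θθ} ℓ_E^q)⁻¹ ∇²_{θπ} ℓ_E^q`. -/
noncomputable def Hπ (F : Framework d n J M T X A) (s : State d n J M X A) (q : ℕ∞) :
    Matrix (Fin M × Fin d) (Fin M) ℝ :=
  -((F.mHess s q)⁻¹ * jacobian (fun π => F.mScore s q s.θ s.θ s.Y s.P π) s.π)

/-- The M-step sensitivity with respect to the previous structural parameter. -/
noncomputable def Hθ' (F : Framework d n J M T X A) (s : State d n J M X A) (q : ℕ∞) :
    Matrix (Fin M × Fin d) (Fin M × Fin d) ℝ :=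
  -((F.mHess s q)⁻¹ * jacobian (fun θ' => F.mScore s q s.θ θ' s.Y s.P s.π) s.θ)

/-- The M-step sensitivity with respect to `Y`. -/
noncomputable def HY (F : Framework d n J M T X A) (s : State d n J M X A) (q : ℕ∞) :
    Matrix (Fin M × Fin d) (Fin M × Fin n) ℝ :=
  -((F.mHess s q)⁻¹ * jacobian (fun Y => F.mScore s q s.θ s.θ Y s.P s.π) s.Y)

/-- The M-step sensitivity with respect to `P`. -/
noncomputable def HP (F : Framework d n J M T X A) (s : State d n J M X A) (q : ℕ∞) :
    Matrix (Fin M × Fin d) (Fin M × CcpIdx J X A) ℝ :=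
  -((F.mHess s q)⁻¹ * jacobian (fun P => F.mScore s q s.θ s.θ s.Y P s.π) s.P)

/-- The rate matrix `R^q` of the EM-NPL(`q`) algorithm at the truth `s`, with rows and columns in
the order `(π, θ, Y, P)`. -/
noncomputable def rateMatrix (F : Framework d n J M T X A) (s : State d n J M X A) (q : ℕ∞) :
    Matrix (StateIdx d n J M X A) (StateIdx d n J M X A) ℝ :=
  let Eπ := jacobian (fun π => F.eStep s π s.P) s.π
  let EP := jacobian (fun P => F.eStep s s.π P) s.P
  let Γθ := jacobian (fun θ => F.stackedΓ q θ s.θ s.Y s.P) s.θ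
  let Γθ' := jacobian (fun θ' => F.stackedΓ q s.θ θ' s.Y s.P) s.θ
  let ΓY := jacobian (fun Y => F.stackedΓ q s.θ s.θ Y s.P) s.Y
  let ΓP := jacobian (fun P => F.stackedΓ q s.θ s.θ s.Y P) s.P
  let Λθ := jacobian (fun θ => F.stackedΛq q θ s.θ s.Y s.P) s.θ
  let Λθ' := jacobian (fun θ' => F.stackedΛq q s.θ θ' s.Y s.P) s.θ
  let ΛY := jacobian (fun Y => F.stackedΛq q s.θ s.θ Y s.P) s.Y
  let ΛP := jacobian (fun P => F.stackedΛq q s.θ s.θ s.Y P) s.P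
  let Hπ := F.Hπ s q
  let Hθ' := F.Hθ' s q
  let HY := F.HY s q
  let HP := F.HP s q
  Matrix.fromRows
    (Matrix.fromCols Eπ (Matrix.fromCols 0 (Matrix.fromCols 0 EP)))
    (Matrix.fromRows
      (Matrix.fromCols Hπ (Matrix.fromCols Hθ' (Matrix.fromCols HY HP)))
      (Matrix.fromRows
        (Matrix.fromCols (Γθ * Hπ)
          (Matrix.fromCols (Γθ * Hθ' + Γθ') (Matrix.fromCols (Γθ * HY + ΓY) (Γθ * HP + ΓP))))
        (Matrix.fromCols (Λθ * Hπ)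
          (Matrix.fromCols (Λθ * Hθ' + Λθ') (Matrix.fromCols (Λθ * HY + ΛY) (Λθ * HP + ΛP))))))

/-! ### Assumptions -/

/-- θ-separability: `G` does not depend on the current structural parameter. -/
def ThetaSeparable (F : Framework d n J M T X A) : Prop :=
  ∀ θ₁ ∈ F.Θ, ∀ θ₂ ∈ F.Θ, ∀ θ' ∈ F.Θ, ∀ P ∈ F.PP, ∀ Y, F.G θ₁ θ' Y P = F.G θ₂ θ' Y P

/-- `Y = G(θ, θ', Y, P)` has a unique solution, which is also the only fixed point of every `Γ^q`,
and `Γ^∞` solves the equation exactly from any initial guess. -/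
structure SameFixedPoint (F : Framework d n J M T X A) : Prop where
  unique : ∀ θ ∈ F.Θ, ∀ θ' ∈ F.Θ, ∀ P ∈ F.PP, ∃! Y, Y ∈ F.YY ∧ F.G θ θ' Y P = Y
  same : ∀ q : ℕ, 1 ≤ q → ∀ θ ∈ F.Θ, ∀ θ' ∈ F.Θ, ∀ P ∈ F.PP, ∀ Y ∈ F.YY,
    (F.Γ q θ θ' P Y = Y ↔ F.G θ θ' Y P = Y)
  exact_top : ∀ θ ∈ F.Θ, ∀ θ' ∈ F.Θ, ∀ P ∈ F.PP, ∀ Y ∈ F.YY,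
    F.Γ ⊤ θ θ' P Y ∈ F.YY ∧ F.G θ θ' (F.Γ ⊤ θ θ' P Y) P = F.Γ ⊤ θ θ' P Y

/-- `s = (π*, θ*, Y*, P*)` is the truth: `π*` is in the interior of the simplex, `θ^{m*}`, `Y^{m*}`
and `P^{m*}` are interior points of their ranges with `Y^{m*} = G(θ^{m*}, θ^{m*}, Y^{m*}, P^{m*})`
and `P^{m*} = Λ(θ^{m*}, Y^{m*}, P^{m*})`, and given its type a market is a stationary Markov
process that visits every state with positive probability. -/
structure IsTruth (F : Framework d n J M T X A) (s : State d n J M X A) : Prop where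
  π_pos : ∀ m, 0 < s.π m
  π_sum : ∑ m, s.π m = 1
  θ_interior : ∀ m, slice s.θ m ∈ interior F.Θ
  Y_interior : ∀ m, slice s.Y m ∈ interior F.YY
  P_interior : ∀ m, slice s.P m ∈ interior F.PP
  Y_eq : ∀ m, F.G (slice s.θ m) (slice s.θ m) (slice s.Y m) (slice s.P m) = slice s.Y m
  P_eq : s.P = F.stackedΛ s.θ s.Y s.P
  trans_nonneg : ∀ x a x', 0 ≤ F.trans x a x'
  trans_sum : ∀ x a, ∑ x', F.trans x a x' = 1
  init_pos : ∀ m x, 0 < F.initDist m x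
  init_sum : ∀ m, ∑ x, F.initDist m x = 1
  stationary : ∀ m x', ∑ x, ∑ a : Fin J → A,
    F.initDist m x * (∏ j, s.P (m, (j, x, a j))) * F.trans x a x' = F.initDist m x'

/-- Around the truth `Γ^q` and `Λ` are thrice continuously differentiable, and the M-step Hessian
is nonsingular there, for every `1 ≤ q ≤ ∞`. -/
structure IsRegular (F : Framework d n J M T X A) (s : State d n J M X A) : Prop where
  smooth_Γ : ∀ q : ℕ∞, 1 ≤ q → ∀ m, ContDiffAt ℝ 3
    (fun z : (Fin d → ℝ) × (Fin d → ℝ) × (CcpIdx J X A → ℝ) × (Fin n → ℝ) =>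
      F.Γ q z.1 z.2.1 z.2.2.1 z.2.2.2)
    (slice s.θ m, slice s.θ m, slice s.P m, slice s.Y m)
  smooth_Λ : ∀ m, ContDiffAt ℝ 3
    (fun z : (Fin d → ℝ) × (Fin n → ℝ) × (CcpIdx J X A → ℝ) => F.Λ z.1 z.2.1 z.2.2)
    (slice s.θ m, slice s.Y m, slice s.P m)
  hess_nonsingular : ∀ q : ℕ∞, 1 ≤ q → IsUnit (F.mHess s q).det

/-- `f` bounds the approximation error of the inner algorithm: `f(q) → 0`, and
`‖Y(θ, θ', P) - Γ^q(θ, θ', P; Y)‖₂ ≤ ‖Y(θ, θ', P) - Y‖₂ f(q)` for all `q ≥ 1` and all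
`(θ, θ', P, Y)` in a neighborhood of `(θ^{m*}, θ^{m*}, P^{m*}, Y^{m*})`, for every type `m`. -/
structure IsErrorBound (F : Framework d n J M T X A) (s : State d n J M X A) (f : ℕ → ℝ) :
    Prop where
  nonneg : ∀ q, 0 ≤ f q
  tendsto_zero : Tendsto f atTop (𝓝 0)
  bound : ∀ m, ∀ᶠ z : (Fin d → ℝ) × (Fin d → ℝ) × (CcpIdx J X A → ℝ) × (Fin n → ℝ) in
      𝓝 (slice s.θ m, slice s.θ m, slice s.P m, slice s.Y m),
    ∀ q : ℕ, 1 ≤ q →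
      l2norm (F.exactSol z.1 z.2.1 z.2.2.1 - F.Γ q z.1 z.2.1 z.2.2.1 z.2.2.2) ≤
        l2norm (F.exactSol z.1 z.2.1 z.2.2.1 - z.2.2.2) * f q

/-- The bound `K̄_q = (log ε - log ‖x₀ - x_*‖₂) / log ρ(R^q)` on the number of outer iterations
needed for `ε`-accuracy from the initial guess `x₀`. -/
noncomputable def iterBound (F : Framework d n J M T X A) (s : State d n J M X A) (q : ℕ∞)
    (ε : ℝ) (x₀ xstar : State d n J M X A) : ℝ :=
  (Real.log ε - Real.log (l2norm (x₀.vec - xstar.vec))) /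
    Real.log (specRadius (F.rateMatrix s q))

end Framework

end EMNPL

/-! The equality of estimators is an identity, while the iteration bound is a perturbation argument
for eigenvalues.

Estimators. The inner algorithm sees `θ` only through the map `y ↦ G(θ, θ', y, P)`, so
θ-separability makes `Γ^q` independent of its first argument on `Θ`. At a fixed point `Y` is
unchanged by `Γ^q`, hence also when a trial value `ϑ` replaces `θ` in the first slot, and the
pseudo-likelihood becomes that of `Λ(ϑ, Y, P)`, in which `q` no longer occurs. Since all `Γ^q` have
the same fixed points, fixed points and objective agree for all `q` (`IsEstimator.change`).

Rate matrices. At the truth `Γ^∞(w) - Y` vanishes and is differentiable, so it is `O(‖w - w₀‖)`. The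
error bound then gives `‖Γ^q(w) - Γ^∞(w)‖ = O(f(q) ‖w - w₀‖)`, and the first derivatives at `w₀`
differ by `O(f(q))` (`isBigO_fderiv_innerMap`). No rate is available for second derivatives, and
none is needed: by separability the M-step gradient does not differentiate through `Γ^q`
(`mScore_eq_outerScore`), so its Jacobians contain only first derivatives of `Γ^q`, and the Hessian
is the same for all `q ≥ 1`. Thus `R^q - R^∞ = O(f(q))` entrywise.

Spectral radius. The polynomial `p = ∏ (X - μ)^ν` over the spectrum of `R^∞` annihilates `R^∞`, so
`p(R^q) = O(f(q))`. For an eigenvalue `z` of `R^q` the number `p(z)` is an eigenvalue of `p(R^q)`,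
so `z` is within `O(f(q)^(1/ν))` of the spectrum of `R^∞`. This bounds `ρ(R^q)` from above; for the
lower bound, continuity of the determinant supplies an eigenvalue of `R^q` near a dominant
eigenvalue of `R^∞`, and the same estimate sharpens its distance. Monotonicity of the logarithm
turns this into the interval for the iteration bounds. -/

namespace EMNPL

/-! ### Hölder perturbation of eigenvalues and of the spectral radius -/

section Spectral

open Polynomial Asymptotics

attribute [local instance] Matrix.linftyOpNormedRing Matrix.linftyOpNormedAlgebra

/-- If `k` bounds the length of all Jordan chains of `f`, then `∏ (X - μ)^k` over the spectrum
annihilates `f`. -/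
theorem aeval_prod_X_sub_C_pow_eq_zero {V : Type*} [AddCommGroup V] [Module ℂ V]
    [FiniteDimensional ℂ V] (f : Module.End ℂ V) (S : Finset ℂ)
    (hS : ∀ μ, f.HasEigenvalue μ → μ ∈ S) (k : ℕ)
    (hk : ∀ μ, f.HasEigenvalue μ → f.maxGenEigenspaceIndex μ ≤ k) :
    aeval f (∏ μ ∈ S, (X - C μ) ^ k) = 0 := by
  -- Over `ℂ` the generalized eigenspaces span `V`, so it suffices to annihilate each of them. The
  -- factors commute, so on the space of `μ` the factor `(X - μ)^k` can be made to act first.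
  rw [← LinearMap.ker_eq_top, eq_top_iff, ← Module.End.iSup_maxGenEigenspace_eq_top f]
  refine iSup_le fun μ v hv => ?_
  by_cases hμ : f.HasEigenvalue μ
  · rw [Module.End.maxGenEigenspace_eq, Module.End.mem_genEigenspace_nat,
      LinearMap.mem_ker] at hv
    rw [LinearMap.mem_ker, ← Finset.prod_erase_mul S _ (hS μ hμ), map_mul, Module.End.mul_apply]
    have h0 : aeval f ((X - C μ) ^ k) v = 0 := by
      rw [← Nat.sub_add_cancel (hk μ hμ), pow_add, map_mul, Module.End.mul_apply]
      have : aeval f ((X - C μ) ^ f.maxGenEigenspaceIndex μ) v = 0 := by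
        simpa [Algebra.algebraMap_eq_smul_one] using hv
      rw [this, map_zero]
    rw [h0, map_zero]
  · have hbot : f.maxGenEigenspace μ = ⊥ := by
      by_contra h
      exact hμ ((Module.End.hasUnifEigenvalue_iff_hasUnifEigenvalue_one (k := ⊤) (by simp)).1 h)
    rw [hbot, Submodule.mem_bot] at hv
    simp [hv]

/-- Sequences that approach limits at a rate `O(f)` with `f → 0` do so after multiplication. -/
theorem isBigO_mul_sub_mul {𝓐 : Type*} [NormedRing 𝓐] {f : ℕ → ℝ} (hf : Tendsto f atTop (𝓝 0))
    {a b : ℕ → 𝓐} {a₀ b₀ : 𝓐} (ha : (fun q => a q - a₀) =O[atTop] f)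
    (hb : (fun q => b q - b₀) =O[atTop] f) :
    (fun q => a q * b q - a₀ * b₀) =O[atTop] f := by
  have hb0 : Tendsto b atTop (𝓝 b₀) := by
    simpa using (hb.trans_tendsto hf).add_const b₀
  have h1 : (fun q => (a q - a₀) * b q) =O[atTop] f := by
    simpa using ha.norm_right.mul (hb0.isBigO_one ℝ)
  have h2 : (fun q => a₀ * (b q - b₀)) =O[atTop] f := hb.const_mul_left a₀
  refine (h1.add h2).congr_left fun q => ?_
  noncomm_ring

/-- To be applied to a polynomial that annihilates the limit `A`, where it makes `p(B q)` itself of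
order `f`. -/
theorem isBigO_aeval_sub_aeval {𝓐 : Type*} [NormedRing 𝓐] [NormedAlgebra ℂ 𝓐] {f : ℕ → ℝ}
    (hf : Tendsto f atTop (𝓝 0)) {B : ℕ → 𝓐} {A : 𝓐} (hB : (fun q => B q - A) =O[atTop] f)
    (p : ℂ[X]) : (fun q => aeval (B q) p - aeval A p) =O[atTop] f := by
  induction p using Polynomial.induction_on' with
  | add p r hp hr =>
    refine (hp.add hr).congr_left fun q => ?_
    simp only [map_add]; abel
  | monomial k c =>
    have hpow : ∀ k : ℕ, (fun q => B q ^ k - A ^ k) =O[atTop] f := by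
      intro k
      induction k with
      | zero => simpa using isBigO_zero _ _
      | succ k ih => simpa only [pow_succ] using isBigO_mul_sub_mul hf ih hB
    have := (hpow k).const_mul_left (algebraMap ℂ 𝓐 c)
    refine this.congr_left fun q => ?_
    simp [aeval_monomial, mul_sub]

/-- A finite product of powers of distances to the points of `S` controls the power of the distance
to the nearest point. -/
theorem exists_mem_norm_sub_pow_le (S : Finset ℂ) (hS : S.Nonempty) (k : ℕ) :
    ∃ c : ℝ, 0 < c ∧ ∀ z : ℂ, ∃ μ ∈ S, ‖z - μ‖ ^ k ≤ c * ∏ ν ∈ S, ‖z - ν‖ ^ k := by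
  have hc : ∀ μ : ℂ, 0 < ∏ ν ∈ S.erase μ, (‖μ - ν‖ / 2) ^ k := fun μ =>
    Finset.prod_pos fun ν hν => by
      have : 0 < ‖μ - ν‖ := norm_pos_iff.2 (sub_ne_zero.2 (Finset.ne_of_mem_erase hν).symm)
      positivity
  -- If `μ` is the point of `S` nearest to `z`, every other `ν` satisfies `‖z - ν‖ ≥ ‖μ - ν‖ / 2`,
  -- which bounds the remaining factors from below. Summing the reciprocals over `S` gives one
  -- constant whatever the nearest point is.
  refine ⟨∑ μ ∈ S, (∏ ν ∈ S.erase μ, (‖μ - ν‖ / 2) ^ k)⁻¹,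
    Finset.sum_pos (fun μ _ => inv_pos.2 (hc μ)) hS, fun z => ?_⟩
  obtain ⟨μ, hμ, hmin⟩ := S.exists_min_image (fun μ => ‖z - μ‖) hS
  refine ⟨μ, hμ, ?_⟩
  have hprod : ∏ ν ∈ S.erase μ, (‖μ - ν‖ / 2) ^ k ≤ ∏ ν ∈ S.erase μ, ‖z - ν‖ ^ k := by
    refine Finset.prod_le_prod (fun _ _ => by positivity) fun ν hν => ?_
    have h1 := hmin ν (Finset.mem_of_mem_erase hν)
    have h2 : ‖μ - ν‖ ≤ ‖z - μ‖ + ‖z - ν‖ := by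
      have := norm_sub_le (z - ν) (z - μ)
      rw [show z - ν - (z - μ) = μ - ν by ring] at this
      linarith
    gcongr
    linarith
  have hle : (∏ ν ∈ S.erase μ, (‖μ - ν‖ / 2) ^ k)⁻¹ ≤
      ∑ μ ∈ S, (∏ ν ∈ S.erase μ, (‖μ - ν‖ / 2) ^ k)⁻¹ :=
    Finset.single_le_sum (f := fun μ => (∏ ν ∈ S.erase μ, (‖μ - ν‖ / 2) ^ k)⁻¹)
      (fun μ _ => (inv_pos.2 (hc μ)).le) hμ
  rw [← Finset.prod_erase_mul S _ hμ]
  calc ‖z - μ‖ ^ k = (∏ ν ∈ S.erase μ, (‖μ - ν‖ / 2) ^ k)⁻¹ *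
        ((∏ ν ∈ S.erase μ, (‖μ - ν‖ / 2) ^ k) * ‖z - μ‖ ^ k) := by
        rw [inv_mul_cancel_left₀ (hc μ).ne']
    _ ≤ _ := by gcongr

variable {ι : Type*} [Fintype ι] [DecidableEq ι]

/-- Hölder estimate for the spectrum: eigenvalues of perturbations lie near those of `A`. -/
theorem exists_eventually_spectrum_near [Nonempty ι] {f : ℕ → ℝ} (hf0 : ∀ q, 0 ≤ f q)
    (hf : Tendsto f atTop (𝓝 0)) {A : Matrix ι ι ℂ} {B : ℕ → Matrix ι ι ℂ}
    (hB : (fun q => B q - A) =O[atTop] f) {k : ℕ} (hk0 : k ≠ 0)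
    (hk : ∀ μ ∈ spectrum ℂ A, Module.End.maxGenEigenspaceIndex (Matrix.toLin' A) μ ≤ k) :
    ∃ C : ℝ, 0 < C ∧ ∀ᶠ q in atTop, ∀ z ∈ spectrum ℂ (B q), ∃ μ ∈ spectrum ℂ A,
      ‖z - μ‖ ≤ C * f q ^ (1 / (k : ℝ)) := by
  have hfin : (spectrum ℂ A).Finite := A.finite_spectrum
  have hne : (spectrum ℂ A).Nonempty := spectrum.nonempty A
  have hmem : ∀ μ, Module.End.HasEigenvalue (Matrix.toLin' A) μ ↔ μ ∈ spectrum ℂ A := fun μ => by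
    rw [Module.End.hasEigenvalue_iff_mem_spectrum, Matrix.spectrum_toLin']
  set p : ℂ[X] := ∏ μ ∈ hfin.toFinset, (X - C μ) ^ k with hp
  have hpA : aeval A p = 0 := by
    have h := aeval_prod_X_sub_C_pow_eq_zero (Matrix.toLin' A) hfin.toFinset
      (fun μ h => by simpa using (hmem μ).1 h) k fun μ h => hk μ ((hmem μ).1 h)
    have h2 : aeval (Matrix.toLinAlgEquiv' A) p = Matrix.toLinAlgEquiv' (aeval A p) :=
      aeval_algHom_apply (Matrix.toLinAlgEquiv' (R := ℂ) (n := ι)).toAlgHom A p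
    have h3 : Matrix.toLinAlgEquiv' (aeval A p) = 0 := h2.symm.trans h
    exact (map_eq_zero_iff _ (Matrix.toLinAlgEquiv' (R := ℂ) (n := ι)).injective).1 h3
  obtain ⟨c, hc, hcS⟩ := exists_mem_norm_sub_pow_le hfin.toFinset (by simpa using hne) k
  obtain ⟨K, hK, hKb⟩ := (isBigO_aeval_sub_aeval hf hB p).exists_pos
  refine ⟨(c * K) ^ (1 / (k : ℝ)), by positivity, ?_⟩
  filter_upwards [hKb.bound] with q hq z hz
  obtain ⟨μ, hμ, hle⟩ := hcS z
  refine ⟨μ, by simpa using hμ, ?_⟩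
  rw [hpA, sub_zero, Real.norm_of_nonneg (hf0 q)] at hq
  -- Spectral mapping: `p(z)` lies in the spectrum of `p(B q)`, hence is bounded by its norm, which
  -- is at most `K f(q)` because `p(A) = 0`.
  have h1 : ‖p.eval z‖ ≤ ‖aeval (B q) p‖ :=
    spectrum.norm_le_norm_of_mem (spectrum.subset_polynomial_aeval (B q) p ⟨z, hz, rfl⟩)
  have h2 : ‖p.eval z‖ = ∏ ν ∈ hfin.toFinset, ‖z - ν‖ ^ k := by
    simp [hp, eval_prod, norm_prod]
  have h3 : ‖z - μ‖ ^ k ≤ c * K * f q := by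
    calc ‖z - μ‖ ^ k ≤ c * ‖p.eval z‖ := h2 ▸ hle
      _ ≤ c * (K * f q) := by gcongr; exact h1.trans hq
      _ = _ := by ring
  rw [← Real.mul_rpow (by positivity) (hf0 q)]
  calc ‖z - μ‖ = (‖z - μ‖ ^ k) ^ (1 / (k : ℝ)) := by
        rw [one_div, Real.pow_rpow_inv_natCast (norm_nonneg _) hk0]
    _ ≤ _ := Real.rpow_le_rpow (by positivity) h3 (by positivity)

/-- Every eigenvalue of a limit matrix is a limit of eigenvalues. -/
theorem eventually_exists_spectrum_near {A : Matrix ι ι ℂ} {B : ℕ → Matrix ι ι ℂ}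
    (hB : Tendsto B atTop (𝓝 A)) {μ : ℂ} (hμ : μ ∈ spectrum ℂ A) {η : ℝ} (hη : 0 < η) :
    ∀ᶠ q in atTop, ∃ z ∈ spectrum ℂ (B q), ‖z - μ‖ < η := by
  have heval : ∀ D : Matrix ι ι ℂ, D.charpoly.eval μ = (Matrix.scalar ι μ - D).det :=
    fun D => Matrix.eval_charpoly D μ
  have h0 : (Matrix.scalar ι μ - A).det = 0 := by
    rw [← heval]; exact Matrix.mem_spectrum_iff_isRoot_charpoly.1 hμ
  have hcont : Continuous fun D : Matrix ι ι ℂ => (Matrix.scalar ι μ - D).det :=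
    (continuous_const.sub continuous_id).matrix_det
  have hlim : Tendsto (fun q => ‖(Matrix.scalar ι μ - B q).det‖) atTop (𝓝 0) := by
    have := ((hcont.tendsto A).comp hB).norm
    rwa [h0, norm_zero] at this
  have hpos : 0 < η ^ Fintype.card ι := by positivity
  filter_upwards [hlim.eventually (gt_mem_nhds hpos)] with q hq
  -- If all eigenvalues of `B q` were at distance at least `η` from `μ`, then `det (μ - B q)`, the
  -- product of the differences, would have modulus at least `η ^ card ι`, although it tends to `det
  -- (μ - A) = 0`.
  by_contra! hcon
  have hsplit := IsAlgClosed.splits (B q).charpoly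
  have hprod : (B q).charpoly.eval μ = (((B q).charpoly.roots).map fun a => μ - a).prod := by
    rw [hsplit.eval_eq_prod_roots_of_monic (B q).charpoly_monic]
  have hcard : (B q).charpoly.roots.card = Fintype.card ι := by
    rw [← hsplit.natDegree_eq_card_roots, Matrix.charpoly_natDegree_eq_dim]
  have hlow : ∀ s : Multiset ℂ, (∀ a ∈ s, η ≤ ‖a - μ‖) →
      η ^ s.card ≤ ‖(s.map fun a => μ - a).prod‖ := by
    intro s
    induction s using Multiset.induction_on with
    | empty => simp
    | cons a s ih =>
      intro h
      rw [Multiset.map_cons, Multiset.prod_cons, norm_mul, Multiset.card_cons, pow_succ']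
      have h1 := h a (Multiset.mem_cons_self a s)
      rw [norm_sub_rev] at h1
      have h2 := ih fun b hb => h b (Multiset.mem_cons_of_mem hb)
      gcongr
  have := hlow (B q).charpoly.roots fun a ha => hcon a
    (Matrix.mem_spectrum_iff_isRoot_charpoly.2 (isRoot_of_mem_roots ha))
  rw [hcard, ← hprod, heval] at this
  linarith

theorem norm_le_specRadius {R : Matrix ι ι ℝ} {z : ℂ} (hz : z ∈ spectrum ℂ (complexify R)) :
    ‖z‖ ≤ specRadius R := by
  have : Nonempty ι := by
    by_contra h
    rw [not_nonempty_iff] at h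
    exact Set.notMem_empty z (by rwa [spectrum.of_subsingleton] at hz)
  have h : (‖z‖₊ : ENNReal) ≤ spectralRadius ℂ (complexify R) :=
    le_iSup₂ (f := fun k (_ : k ∈ spectrum ℂ (complexify R)) => (‖k‖₊ : ENNReal)) z hz
  have hfin : spectralRadius ℂ (complexify R) ≠ ⊤ :=
    ((spectrum.spectralRadius_le_nnnorm (𝕜 := ℂ) (complexify R)).trans_lt ENNReal.coe_lt_top).ne
  have := ENNReal.toReal_mono hfin h
  simpa [specRadius] using this

theorem exists_norm_eq_specRadius [Nonempty ι] (R : Matrix ι ι ℝ) :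
    ∃ z ∈ spectrum ℂ (complexify R), ‖z‖ = specRadius R := by
  obtain ⟨z, hz, h⟩ := spectrum.exists_nnnorm_eq_spectralRadius (complexify R)
  exact ⟨z, hz, by simp [specRadius, ← h]⟩

theorem jordanIndex_le_largestJordanBlock (R : Matrix ι ι ℝ) {μ : ℂ}
    (hμ : μ ∈ spectrum ℂ (complexify R)) : jordanIndex R μ ≤ largestJordanBlock R :=
  le_csSup (((complexify R).finite_spectrum.image _).bddAbove) ⟨μ, hμ, rfl⟩

/-- Index `0` would make the generalized eigenspace of an eigenvalue the kernel of the identity.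
Without this the exponent `1 / ν` would be `1 / 0 = 0` and the bound `C * f q ^ 0` would not tend to
zero. -/
theorem largestJordanBlock_ne_zero [Nonempty ι] (R : Matrix ι ι ℝ) : largestJordanBlock R ≠ 0 := by
  obtain ⟨μ, hμ⟩ := spectrum.nonempty (complexify R)
  refine (Nat.lt_of_lt_of_le (Nat.pos_of_ne_zero fun h => ?_)
    (jordanIndex_le_largestJordanBlock R hμ)).ne'
  have hev : Module.End.HasEigenvalue (Matrix.toLin' (complexify R)) μ := by
    rwa [Module.End.hasEigenvalue_iff_mem_spectrum, Matrix.spectrum_toLin']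
  apply hev
  have h1 := Module.End.eigenspace_le_maxGenEigenspace (f := Matrix.toLin' (complexify R)) (μ := μ)
  rw [Module.End.maxGenEigenspace_eq] at h1
  rw [jordanIndex] at h
  rw [h] at h1
  simpa using h1

/-- Hölder estimate for the spectral radius, with the reciprocal of the size of the largest Jordan
block of the limit as exponent. -/
theorem exists_eventually_abs_specRadius_sub_le [Nonempty ι] {f : ℕ → ℝ} (hf0 : ∀ q, 0 ≤ f q)
    (hf : Tendsto f atTop (𝓝 0)) {R : ℕ → Matrix ι ι ℝ} {R₀ : Matrix ι ι ℝ}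
    (hR : ∀ i j, (fun q => R q i j - R₀ i j) =O[atTop] f) :
    ∃ C : ℝ, 0 < C ∧ ∀ᶠ q in atTop,
      |specRadius (R q) - specRadius R₀| ≤ C * f q ^ (1 / (largestJordanBlock R₀ : ℝ)) := by
  have hB : (fun q => complexify (R q) - complexify R₀) =O[atTop] f := by
    have h1 : (fun q => ∑ i, ∑ j,
        ((R q i j - R₀ i j : ℝ) : ℂ) • Matrix.single i j (1 : ℂ)) =O[atTop] f := by
      refine IsBigO.fun_sum fun i _ => IsBigO.fun_sum fun j _ => ?_
      have h2 : (fun q => ((R q i j - R₀ i j : ℝ) : ℂ)) =O[atTop] f :=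
        (Complex.isBigO_ofReal_left).2 (hR i j)
      simpa using h2.smul (isBigO_const_const (Matrix.single i j (1 : ℂ)) (one_ne_zero (α := ℝ)) _)
    refine h1.congr_left fun q => ?_
    conv_rhs => rw [Matrix.matrix_eq_sum_single (complexify (R q) - complexify R₀)]
    simp [complexify]
  have hk0 := largestJordanBlock_ne_zero R₀
  set k := largestJordanBlock R₀
  obtain ⟨C, hC, hnear⟩ := exists_eventually_spectrum_near hf0 hf hB hk0
    fun μ hμ => jordanIndex_le_largestJordanBlock R₀ hμ
  have hlim : Tendsto (fun q => complexify (R q)) atTop (𝓝 (complexify R₀)) := by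
    have h := (hB.trans_tendsto hf).add_const (complexify R₀)
    simp only [sub_add_cancel, zero_add] at h
    exact h
  have hg : Tendsto (fun q => C * f q ^ (1 / (k : ℝ))) atTop (𝓝 0) := by
    have hk : (0 : ℝ) < 1 / (k : ℝ) := by positivity
    have := (hf.rpow_const (p := 1 / (k : ℝ)) (Or.inr hk.le)).const_mul C
    rwa [Real.zero_rpow hk.ne', mul_zero] at this
  obtain ⟨μ, hμ, hμR⟩ := exists_norm_eq_specRadius R₀
  -- The spectrum is finite, so the dominant eigenvalue `μ` is isolated. An eigenvalue of `R q`
  -- within `δ / 2` of `μ`, whose Hölder partner in the spectrum of `R₀` is also within `δ / 2` of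
  -- it, can only have `μ` as that partner.
  obtain ⟨δ, hδ, hsep⟩ : ∃ δ > 0, ∀ μ' ∈ spectrum ℂ (complexify R₀), ‖μ - μ'‖ < δ → μ' = μ := by
    have hopen : ((spectrum ℂ (complexify R₀)) \ {μ})ᶜ ∈ 𝓝 μ :=
      ((complexify R₀).finite_spectrum.subset Set.sdiff_subset).isClosed.isOpen_compl.mem_nhds
        (by simp)
    obtain ⟨δ, hδ, hsub⟩ := Metric.mem_nhds_iff.1 hopen
    refine ⟨δ, hδ, fun μ' hμ' hd => ?_⟩
    by_contra hne
    exact hsub (a := μ') (by rwa [Metric.mem_ball, dist_comm, dist_eq_norm]) ⟨hμ', hne⟩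
  refine ⟨C, hC, ?_⟩
  filter_upwards [hnear, eventually_exists_spectrum_near hlim hμ (half_pos hδ),
    hg.eventually (gt_mem_nhds (half_pos hδ))] with q hq hclose hsmall
  rw [abs_sub_le_iff]
  constructor
  · obtain ⟨z, hz, hzR⟩ := exists_norm_eq_specRadius (R q)
    obtain ⟨μ', hμ', hd⟩ := hq z hz
    have h1 := norm_le_specRadius hμ'
    have h2 := norm_sub_norm_le z μ'
    linarith
  · obtain ⟨z, hz, hzμ⟩ := hclose
    obtain ⟨μ', hμ', hd⟩ := hq z hz
    have hμμ' : μ' = μ := by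
      refine hsep μ' hμ' ?_
      have := norm_sub_le (z - μ') (z - μ)
      rw [show z - μ' - (z - μ) = μ - μ' by ring] at this
      linarith
    rw [hμμ', norm_sub_rev] at hd
    have h1 := norm_le_specRadius hz
    have h2 := norm_sub_norm_le μ z
    linarith

end Spectral

/-! ### The number of inner steps does not affect the estimators -/

namespace Framework

variable {d n J M T : ℕ} {X A : Type*} {F : Framework d n J M T X A}

/-- Separability holds at every `Y`, not only on `YY`, so the algorithm receives literally the same
map and its output agrees for every `q`. -/
theorem Γ_congr (hsep : F.ThetaSeparable) (q : ℕ∞) {θ₁ θ₂ θ' : Fin d → ℝ}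
    {P : CcpIdx J X A → ℝ} (h₁ : θ₁ ∈ F.Θ) (h₂ : θ₂ ∈ F.Θ) (h' : θ' ∈ F.Θ) (hP : P ∈ F.PP)
    (Y : Fin n → ℝ) : F.Γ q θ₁ θ' P Y = F.Γ q θ₂ θ' P Y := by
  have : (fun y => F.G θ₁ θ' y P) = fun y => F.G θ₂ θ' y P :=
    funext fun y => hsep θ₁ h₁ θ₂ h₂ θ' h' P hP y
  simp only [Γ, this]

theorem stackedΓ_congr (hsep : F.ThetaSeparable) (q : ℕ∞) {θ₁ θ₂ θ' : Fin M × Fin d → ℝ}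
    {P : Fin M × CcpIdx J X A → ℝ} (h₁ : ∀ m, slice θ₁ m ∈ F.Θ) (h₂ : ∀ m, slice θ₂ m ∈ F.Θ)
    (h' : ∀ m, slice θ' m ∈ F.Θ) (hP : ∀ m, slice P m ∈ F.PP) (Y : Fin M × Fin n → ℝ) :
    F.stackedΓ q θ₁ θ' Y P = F.stackedΓ q θ₂ θ' Y P :=
  funext fun k => congrFun (Γ_congr hsep q (h₁ k.1) (h₂ k.1) (h' k.1) (hP k.1) _) k.2

/-- `Γ^∞` returns the exact solution. -/
theorem SameFixedPoint.Γ_top_eq_exactSol (hfix : F.SameFixedPoint) {θ θ' : Fin d → ℝ}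
    {P : CcpIdx J X A → ℝ} {Y : Fin n → ℝ} (hθ : θ ∈ F.Θ) (hθ' : θ' ∈ F.Θ) (hP : P ∈ F.PP)
    (hY : Y ∈ F.YY) : F.Γ ⊤ θ θ' P Y = F.exactSol θ θ' P := by
  have hex := hfix.unique θ hθ θ' hθ' P hP
  exact hex.unique (hfix.exact_top θ hθ θ' hθ' P hP Y hY) (Classical.epsilon_spec hex.exists)

theorem SameFixedPoint.Γ_eq_iff (hfix : F.SameFixedPoint) {q : ℕ∞} (hq : 1 ≤ q)
    {θ θ' : Fin d → ℝ} {P : CcpIdx J X A → ℝ} {Y : Fin n → ℝ} (hθ : θ ∈ F.Θ) (hθ' : θ' ∈ F.Θ)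
    (hP : P ∈ F.PP) (hY : Y ∈ F.YY) : F.Γ q θ θ' P Y = Y ↔ F.G θ θ' Y P = Y := by
  induction q using ENat.recTopCoe with
  | top =>
    have h := hfix.exact_top θ hθ θ' hθ' P hP Y hY
    exact ⟨fun he => by simpa only [he] using h.2,
      fun he => (hfix.unique θ hθ θ' hθ' P hP).unique h ⟨hY, he⟩⟩
  | coe q => exact hfix.same q (by exact_mod_cast hq) θ hθ θ' hθ' P hP Y hY

theorem SameFixedPoint.stackedΓ_eq_iff (hfix : F.SameFixedPoint) {q : ℕ∞} (hq : 1 ≤ q)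
    {θ θ' : Fin M × Fin d → ℝ} {P : Fin M × CcpIdx J X A → ℝ} {Y : Fin M × Fin n → ℝ}
    (hθ : ∀ m, slice θ m ∈ F.Θ) (hθ' : ∀ m, slice θ' m ∈ F.Θ) (hP : ∀ m, slice P m ∈ F.PP)
    (hY : ∀ m, slice Y m ∈ F.YY) : F.stackedΓ q θ θ' Y P = Y ↔
      ∀ m, F.G (slice θ m) (slice θ' m) (slice Y m) (slice P m) = slice Y m := by
  simp only [← fun m => hfix.Γ_eq_iff hq (hθ m) (hθ' m) (hP m) (hY m)]
  exact ⟨fun h m => funext fun i => congrFun h (m, i),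
    fun h => funext fun k => congrFun (h k.1) k.2⟩

/-- This removes `q` from the pseudo-likelihood: a trial value in the first slot leaves the fixed
`Y` where it is. -/
theorem stackedΓ_eq_self (hsep : F.ThetaSeparable) {q : ℕ∞}
    {θ θ' : Fin M × Fin d → ℝ} {P : Fin M × CcpIdx J X A → ℝ} {Y : Fin M × Fin n → ℝ}
    (hθ : ∀ m, slice θ m ∈ F.Θ) (hθ' : ∀ m, slice θ' m ∈ F.Θ) (hP : ∀ m, slice P m ∈ F.PP)
    (h : F.stackedΓ q θ' θ' Y P = Y) : F.stackedΓ q θ θ' Y P = Y := by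
  rw [stackedΓ_congr hsep q hθ hθ' hθ' hP, h]

variable [Fintype A]

theorem pseudoLik_congr (hsep : F.ThetaSeparable) {q r : ℕ∞} {N : ℕ}
    (data : Fin N → Panel T J X A) {θ θ' : Fin M × Fin d → ℝ} {P : Fin M × CcpIdx J X A → ℝ}
    {Y : Fin M × Fin n → ℝ} (hθ : ∀ m, slice θ m ∈ F.Θ) (hθ' : ∀ m, slice θ' m ∈ F.Θ)
    (hP : ∀ m, slice P m ∈ F.PP) (hq : F.stackedΓ q θ' θ' Y P = Y)
    (hr : F.stackedΓ r θ' θ' Y P = Y) (π : Fin M → ℝ) :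
    F.pseudoLik q data θ π θ' Y P = F.pseudoLik r data θ π θ' Y P := by
  simp only [pseudoLik, stackedΛq, stackedΓ_eq_self hsep hθ hθ' hP hq,
    stackedΓ_eq_self hsep hθ hθ' hP hr]

theorem IsFixedPoint.stackedΓ_eq (hfix : F.SameFixedPoint) {q r : ℕ∞} (hq : 1 ≤ q) (hr : 1 ≤ r)
    {N : ℕ} {data : Fin N → Panel T J X A} {x : State d n J M X A} (hx : F.IsFixedPoint q data x) :
    F.stackedΓ r x.θ x.θ x.Y x.P = x.Y := by
  rw [hfix.stackedΓ_eq_iff hr hx.mem_Θ hx.mem_Θ hx.mem_PP hx.mem_YY,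
    ← hfix.stackedΓ_eq_iff hq hx.mem_Θ hx.mem_Θ hx.mem_PP hx.mem_YY]
  exact hx.fixed_Y.symm

theorem IsFixedPoint.pseudoLik_eq (hsep : F.ThetaSeparable) (hfix : F.SameFixedPoint) {q r : ℕ∞}
    (hq : 1 ≤ q) (hr : 1 ≤ r) {N : ℕ} {data : Fin N → Panel T J X A} {x : State d n J M X A}
    (hx : F.IsFixedPoint q data x) {ϑ : Fin M × Fin d → ℝ} (hϑ : ∀ m, slice ϑ m ∈ F.Θ)
    (ϖ : Fin M → ℝ) :
    F.pseudoLik q data ϑ ϖ x.θ x.Y x.P = F.pseudoLik r data ϑ ϖ x.θ x.Y x.P :=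
  pseudoLik_congr hsep data hϑ hx.mem_Θ hx.mem_PP hx.fixed_Y.symm (hx.stackedΓ_eq hfix hq hr) ϖ

/-- The hypotheses are symmetric in `q` and `r`, so this one implication identifies the two sets of
fixed points. -/
theorem IsFixedPoint.change (hsep : F.ThetaSeparable) (hfix : F.SameFixedPoint) {q r : ℕ∞}
    (hq : 1 ≤ q) (hr : 1 ≤ r) {N : ℕ} {data : Fin N → Panel T J X A} {x : State d n J M X A}
    (hx : F.IsFixedPoint q data x) : F.IsFixedPoint r data x where
  mem_Θ := hx.mem_Θ
  mem_simplex := hx.mem_simplex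
  mem_YY := hx.mem_YY
  mem_PP := hx.mem_PP
  argmax ϑ ϖ hϑ hϖ := by
    rw [← hx.pseudoLik_eq hsep hfix hq hr hϑ, ← hx.pseudoLik_eq hsep hfix hq hr hx.mem_Θ]
    exact hx.argmax ϑ ϖ hϑ hϖ
  fixed_Y := (hx.stackedΓ_eq hfix hq hr).symm
  fixed_P := hx.fixed_P

theorem IsEstimator.change (hsep : F.ThetaSeparable) (hfix : F.SameFixedPoint) {q r : ℕ∞}
    (hq : 1 ≤ q) (hr : 1 ≤ r) {N : ℕ} {data : Fin N → Panel T J X A} {x : State d n J M X A}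
    (hx : F.IsEstimator q data x) : F.IsEstimator r data x := by
  refine ⟨hx.1.change hsep hfix hq hr, fun x' hx' => ?_⟩
  rw [hx'.pseudoLik_eq hsep hfix hr hq hx'.mem_Θ, ← hx.1.pseudoLik_eq hsep hfix hq hr hx.1.mem_Θ]
  exact hx.2 x' (hx'.change hsep hfix hr hq)

end Framework

open Asymptotics

/-! ### Convergence of Jacobians at a prescribed rate -/

section Jacobians

theorem jacobian_apply {ι κ : Type*} [Fintype ι] [Fintype κ] [DecidableEq κ]
    (h : (κ → ℝ) → (ι → ℝ)) (z : κ → ℝ) (i : ι) (j : κ) :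
    jacobian h z i j = fderiv ℝ h z (Pi.single j 1) i := by
  simp [jacobian, LinearMap.toMatrix'_apply]

/-- The matrices `B q` with `q → ∞` approach `B ⊤` entrywise at the rate `f`. -/
def ConvergesAtRate {ι κ : Type*} (f : ℕ → ℝ) (B : ℕ∞ → Matrix ι κ ℝ) : Prop :=
  ∀ i j, (fun q : ℕ => B q i j - B ⊤ i j) =O[atTop] f

namespace ConvergesAtRate

variable {ι κ μ : Type*} {f : ℕ → ℝ}

theorem of_eq {B : ℕ∞ → Matrix ι κ ℝ} (h : ∀ q, 1 ≤ q → B q = B ⊤) : ConvergesAtRate f B := by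
  intro i j
  refine (isBigO_zero f atTop).congr' ?_ EventuallyEq.rfl
  filter_upwards [eventually_ge_atTop 1] with q hq
  rw [h q (by exact_mod_cast hq), sub_self]

theorem add {B D : ℕ∞ → Matrix ι κ ℝ} (hB : ConvergesAtRate f B) (hD : ConvergesAtRate f D) :
    ConvergesAtRate f fun q => B q + D q := fun i j =>
  ((hB i j).add (hD i j)).congr_left fun q => by simp only [Matrix.add_apply]; ring

theorem neg {B : ℕ∞ → Matrix ι κ ℝ} (hB : ConvergesAtRate f B) :
    ConvergesAtRate f fun q => -B q := fun i j =>
  (hB i j).neg_left.congr_left fun q => by simp only [Matrix.neg_apply]; ring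

theorem mul [Fintype κ] (hf : Tendsto f atTop (𝓝 0)) {B : ℕ∞ → Matrix ι κ ℝ}
    {D : ℕ∞ → Matrix κ μ ℝ} (hB : ConvergesAtRate f B) (hD : ConvergesAtRate f D) :
    ConvergesAtRate f fun q => B q * D q := fun i j => by
  have := IsBigO.fun_sum (s := Finset.univ) fun k (_ : k ∈ Finset.univ) =>
    isBigO_mul_sub_mul hf (hB i k) (hD k j)
  refine this.congr_left fun q => ?_
  simp only [Matrix.mul_apply, Finset.sum_sub_distrib]

theorem fromCols {κ' : Type*} {B : ℕ∞ → Matrix ι κ ℝ} {D : ℕ∞ → Matrix ι κ' ℝ}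
    (hB : ConvergesAtRate f B) (hD : ConvergesAtRate f D) :
    ConvergesAtRate f fun q => Matrix.fromCols (B q) (D q)
  | i, Sum.inl j => hB i j
  | i, Sum.inr j => hD i j

theorem fromRows {ι' : Type*} {B : ℕ∞ → Matrix ι κ ℝ} {D : ℕ∞ → Matrix ι' κ ℝ}
    (hB : ConvergesAtRate f B) (hD : ConvergesAtRate f D) :
    ConvergesAtRate f fun q => Matrix.fromRows (B q) (D q)
  | Sum.inl i, j => hB i j
  | Sum.inr i, j => hD i j

/-- If the derivatives of `γ q` at a common value converge at the rate `f`, then so do the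
Jacobians of compositions with fixed maps. -/
theorem jacobian_comp [Fintype ι] [Fintype κ] [DecidableEq κ] {W V Z : Type*}
    [NormedAddCommGroup W] [NormedSpace ℝ W] [NormedAddCommGroup V] [NormedSpace ℝ V]
    [NormedAddCommGroup Z] [NormedSpace ℝ Z] {γ : ℕ∞ → W → V} {w₀ : W} {v₀ : V}
    (hγ : ∀ q, 1 ≤ q → DifferentiableAt ℝ (γ q) w₀) (hv₀ : ∀ q, 1 ≤ q → γ q w₀ = v₀)
    (hbd : (fun q : ℕ => fderiv ℝ (γ q) w₀ - fderiv ℝ (γ ⊤) w₀) =O[atTop] f)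
    {Ψ : Z × V → ι → ℝ} {z₀ : Z} (hΨ : DifferentiableAt ℝ Ψ (z₀, v₀))
    {e : κ → ℝ} {c : (κ → ℝ) → Z} (hc : DifferentiableAt ℝ c e) (hce : c e = z₀)
    {u : (κ → ℝ) → W} (hu : DifferentiableAt ℝ u e) (hue : u e = w₀)
    {h : ℕ∞ → (κ → ℝ) → (ι → ℝ)}
    (hh : ∀ q, 1 ≤ q → h q =ᶠ[𝓝 e] fun x => Ψ (c x, γ q (u x))) :
    ConvergesAtRate f fun q => jacobian (h q) e := by
  -- Because `γ q w₀ = v₀` for all `q`, the outer derivative is always taken at the same point, and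
  -- `q` enters only through `fderiv ℝ (γ q) w₀`, affinely. The contribution of `c` therefore
  -- cancels in differences.
  have hder : ∀ q, 1 ≤ q → fderiv ℝ (h q) e = (fderiv ℝ Ψ (z₀, v₀)).comp
      ((fderiv ℝ c e).prod ((fderiv ℝ (γ q) w₀).comp (fderiv ℝ u e))) := by
    intro q hq
    rw [(hh q hq).fderiv_eq]
    have h1 : HasFDerivAt (γ q) (fderiv ℝ (γ q) w₀) (u e) := hue ▸ (hγ q hq).hasFDerivAt
    have h2 := hc.hasFDerivAt.prodMk (h1.comp e hu.hasFDerivAt)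
    have h3 : HasFDerivAt Ψ (fderiv ℝ Ψ (z₀, v₀)) (c e, γ q (u e)) := by
      rw [hce, hue, hv₀ q hq]; exact hΨ.hasFDerivAt
    exact (HasFDerivAt.comp e h3 h2).fderiv
  intro i j
  set w := fderiv ℝ u e (Pi.single j 1)
  have h1 : (fun q : ℕ => (fderiv ℝ (γ q) w₀ - fderiv ℝ (γ ⊤) w₀) w) =O[atTop] f :=
    (IsBigO.of_bound ‖w‖ (Eventually.of_forall fun q => by
      rw [mul_comm]; exact ContinuousLinearMap.le_opNorm _ w)).trans hbd
  have h2 : (fun q : ℕ => ((ContinuousLinearMap.proj i : (ι → ℝ) →L[ℝ] ℝ).comp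
      ((fderiv ℝ Ψ (z₀, v₀)).comp (ContinuousLinearMap.inr ℝ Z V)))
      ((fderiv ℝ (γ q) w₀ - fderiv ℝ (γ ⊤) w₀) w)) =O[atTop] f :=
    (ContinuousLinearMap.isBigO_comp _ _ _).trans h1
  refine h2.congr' ?_ EventuallyEq.rfl
  filter_upwards [eventually_ge_atTop 1] with q hq
  rw [jacobian_apply, jacobian_apply, hder q (by exact_mod_cast hq), hder ⊤ le_top]
  have h3 := congrFun (map_sub (fderiv ℝ Ψ (z₀, v₀))
    (fderiv ℝ c e (Pi.single j 1), fderiv ℝ (γ q) w₀ w)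
    (fderiv ℝ c e (Pi.single j 1), fderiv ℝ (γ ⊤) w₀ w)) i
  rw [Prod.mk_sub_mk, sub_self] at h3
  exact h3

end ConvergesAtRate

end Jacobians

theorem abs_le_l2norm {ι : Type*} [Fintype ι] (v : ι → ℝ) (i : ι) : |v i| ≤ l2norm v := by
  rw [l2norm, ← Real.sqrt_sq_eq_abs]
  exact Real.sqrt_le_sqrt
    (Finset.single_le_sum (f := fun i => v i ^ 2) (fun _ _ => sq_nonneg _) (Finset.mem_univ i))

theorem l2norm_le_card_mul {ι : Type*} [Fintype ι] {v : ι → ℝ} {c : ℝ} (hv : ∀ i, |v i| ≤ c) :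
    l2norm v ≤ Fintype.card ι * c := by
  have h1 : l2norm v ≤ ∑ i, |v i| := by
    refine Real.sqrt_le_iff.2 ⟨Finset.sum_nonneg fun _ _ => abs_nonneg _, ?_⟩
    simpa only [sq_abs] using
      Finset.sum_sq_le_sq_sum_of_nonneg (s := Finset.univ) (f := fun i => |v i|)
        fun _ _ => abs_nonneg _
  calc l2norm v ≤ ∑ i, |v i| := h1
    _ ≤ ∑ _i : ι, c := Finset.sum_le_sum fun i _ => hv i
    _ = _ := by simp

/-- The type-`m` component as a continuous linear map. -/
def sliceL {M : ℕ} {ι : Type*} (m : Fin M) : (Fin M × ι → ℝ) →L[ℝ] (ι → ℝ) :=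
  ContinuousLinearMap.pi fun i => ContinuousLinearMap.proj (m, i)

theorem continuous_slice {M : ℕ} {ι : Type*} (m : Fin M) :
    Continuous fun z : Fin M × ι → ℝ => slice z m := (sliceL m).continuous

theorem eventually_slice_mem {M : ℕ} {ι : Type*} {S : Set (ι → ℝ)} {z : Fin M × ι → ℝ}
    (hz : ∀ m, slice z m ∈ interior S) : ∀ᶠ y in 𝓝 z, ∀ m, slice y m ∈ interior S :=
  eventually_all.2 fun m =>
    (continuous_slice m).continuousAt.eventually (isOpen_interior.mem_nhds (hz m))

/-! ### Derivatives of the inner algorithm and of the M-step score at the truth -/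

namespace Framework

/-- Arguments `(θ, θ', Y, P)` of the stacked mapping `Γ^q`. -/
abbrev InnerArg (d n J M : ℕ) (X A : Type*) :=
  (Fin M × Fin d → ℝ) × (Fin M × Fin d → ℝ) × (Fin M × Fin n → ℝ) × (Fin M × CcpIdx J X A → ℝ)

variable {d n J M T : ℕ} {X A : Type*} {F : Framework d n J M T X A} {s : State d n J M X A}

theorem Λ_pos [Fintype A] (θ : Fin d → ℝ) (Y : Fin n → ℝ) (P : CcpIdx J X A → ℝ) (i : CcpIdx J X A) :
    0 < F.Λ θ Y P i :=
  div_pos (Real.exp_pos _) (Finset.sum_pos (fun _ _ => Real.exp_pos _) ⟨i.2.2, Finset.mem_univ _⟩)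

/-- `Γ^q` as a function of one argument. -/
def innerMap (F : Framework d n J M T X A) (q : ℕ∞) (w : InnerArg d n J M X A) :
    Fin M × Fin n → ℝ :=
  F.stackedΓ q w.1 w.2.1 w.2.2.1 w.2.2.2

/-- The argument of `Γ^q` at the point `s`. -/
def innerArg (s : State d n J M X A) : InnerArg d n J M X A := (s.θ, s.θ, s.Y, s.P)

/-- All components lie in the interiors of their ranges. -/
structure IsInterior (F : Framework d n J M T X A) (w : InnerArg d n J M X A) : Prop where
  θ : ∀ m, slice w.1 m ∈ interior F.Θ
  θ' : ∀ m, slice w.2.1 m ∈ interior F.Θ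
  Y : ∀ m, slice w.2.2.1 m ∈ interior F.YY
  P : ∀ m, slice w.2.2.2 m ∈ interior F.PP

section

variable [Fintype X] [Fintype A]

theorem IsTruth.isInterior (h : F.IsTruth s) : F.IsInterior (innerArg s) :=
  ⟨h.θ_interior, h.θ_interior, h.Y_interior, h.P_interior⟩

/-- Supplies the common base value that `ConvergesAtRate.jacobian_comp` requires. -/
theorem IsTruth.innerMap_eq (h : F.IsTruth s) (hfix : F.SameFixedPoint) (q : ℕ∞) (hq : 1 ≤ q) :
    F.innerMap q (innerArg s) = s.Y :=
  (hfix.stackedΓ_eq_iff hq (fun m => interior_subset (h.θ_interior m))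
    (fun m => interior_subset (h.θ_interior m)) (fun m => interior_subset (h.P_interior m))
    (fun m => interior_subset (h.Y_interior m))).2 h.Y_eq

end

theorem IsInterior.eventually {w₀ : InnerArg d n J M X A} (h : F.IsInterior w₀) :
    ∀ᶠ w in 𝓝 w₀, F.IsInterior w := by
  have h1 := (continuous_fst.continuousAt (x := w₀)).eventually (eventually_slice_mem h.θ)
  have h2 := ((continuous_fst.comp continuous_snd).continuousAt (x := w₀)).eventually
    (eventually_slice_mem h.θ')
  have h3 := ((continuous_fst.comp (continuous_snd.comp continuous_snd)).continuousAt
    (x := w₀)).eventually (eventually_slice_mem h.Y)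
  have h4 := ((continuous_snd.comp (continuous_snd.comp continuous_snd)).continuousAt
    (x := w₀)).eventually (eventually_slice_mem h.P)
  filter_upwards [h1, h2, h3, h4] with w a b c e using ⟨a, b, c, e⟩

variable [Fintype X] [Fintype A]

theorem IsRegular.differentiableAt_innerMap [DecidableEq X] [DecidableEq A]
    (hreg : F.IsRegular s) (q : ℕ∞) (hq : 1 ≤ q) :
    DifferentiableAt ℝ (F.innerMap q) (innerArg s) := by
  refine differentiableAt_pi.2 fun k => ?_
  have h1 := (hreg.smooth_Γ q hq k.1).differentiableAt (by norm_num)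
  have h2 : DifferentiableAt ℝ (fun w : InnerArg d n J M X A =>
      (sliceL k.1 w.1, sliceL k.1 w.2.1, sliceL k.1 w.2.2.2, sliceL k.1 w.2.2.1))
      (innerArg s) := by fun_prop
  exact differentiableAt_pi.1 (DifferentiableAt.comp (innerArg s) h1 h2) k.2

/-- The error bound is relative to the initial error `Γ^∞(w) - Y`, which is itself `O(‖w - w₀‖)`. So
`Γ^q - Γ^∞` vanishes at `w₀` and grows there at most linearly with slope `O(f q)`, and this slope
bounds its derivative. -/
theorem IsErrorBound.isBigO_fderiv_innerMap [DecidableEq X] [DecidableEq A] {f : ℕ → ℝ}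
    (hf : F.IsErrorBound s f) (hfix : F.SameFixedPoint) (htruth : F.IsTruth s)
    (hreg : F.IsRegular s) :
    (fun q : ℕ => fderiv ℝ (F.innerMap q) (innerArg s) - fderiv ℝ (F.innerMap ⊤) (innerArg s))
      =O[atTop] f := by
  set w₀ := innerArg s
  have hdtop := hreg.differentiableAt_innerMap ⊤ le_top
  have hg : DifferentiableAt ℝ
      (fun w : InnerArg d n J M X A => F.innerMap ⊤ w - w.2.2.1) w₀ :=
    hdtop.sub (by fun_prop)
  obtain ⟨L, hL, hLb⟩ := hg.hasFDerivAt.isBigO_sub.exists_pos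
  have hg0 : F.innerMap ⊤ w₀ - w₀.2.2.1 = 0 := by
    rw [htruth.innerMap_eq hfix ⊤ le_top]; exact sub_self _
  have hbound : ∀ᶠ w in 𝓝 w₀, ∀ m, ∀ q : ℕ, 1 ≤ q →
      l2norm (F.exactSol (slice w.1 m) (slice w.2.1 m) (slice w.2.2.2 m) -
        F.Γ q (slice w.1 m) (slice w.2.1 m) (slice w.2.2.2 m) (slice w.2.2.1 m)) ≤
      l2norm (F.exactSol (slice w.1 m) (slice w.2.1 m) (slice w.2.2.2 m) - slice w.2.2.1 m)
        * f q := by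
    refine eventually_all.2 fun m => ?_
    have hc : Continuous (fun w : InnerArg d n J M X A =>
        (sliceL m w.1, sliceL m w.2.1, sliceL m w.2.2.2, sliceL m w.2.2.1)) := by fun_prop
    exact (hc.continuousAt (x := w₀)).eventually (hf.bound m)
  -- The factor `n` is the price of passing from the sup norm to the Euclidean norm of the error
  -- bound. Restricting to interior `w` permits replacing `exactSol` by `Γ^∞`.
  have key : ∀ᶠ w in 𝓝 w₀, ∀ q : ℕ, 1 ≤ q →
      ‖F.innerMap q w - F.innerMap ⊤ w‖ ≤ n * L * f q * ‖w - w₀‖ := by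
    filter_upwards [hLb.bound, hbound, htruth.isInterior.eventually] with w h1 h2 hI q hq
    rw [hg0, sub_zero] at h1
    have hfq := hf.nonneg q
    refine (pi_norm_le_iff_of_nonneg (by positivity)).2 fun k => ?_
    have h3 := h2 k.1 q hq
    rw [← hfix.Γ_top_eq_exactSol (interior_subset (hI.θ k.1)) (interior_subset (hI.θ' k.1))
      (interior_subset (hI.P k.1)) (interior_subset (hI.Y k.1))] at h3
    have h4 : l2norm (F.Γ ⊤ (slice w.1 k.1) (slice w.2.1 k.1) (slice w.2.2.2 k.1)
        (slice w.2.2.1 k.1) - slice w.2.2.1 k.1) ≤ n * (L * ‖w - w₀‖) := by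
      have := l2norm_le_card_mul (v := F.Γ ⊤ (slice w.1 k.1) (slice w.2.1 k.1)
        (slice w.2.2.2 k.1) (slice w.2.2.1 k.1) - slice w.2.2.1 k.1) (c := L * ‖w - w₀‖)
        fun i => (norm_le_pi_norm (F.innerMap ⊤ w - w.2.2.1) (k.1, i)).trans h1
      simpa using this
    have h5 := abs_le_l2norm (F.Γ ⊤ (slice w.1 k.1) (slice w.2.1 k.1) (slice w.2.2.2 k.1)
      (slice w.2.2.1 k.1) - F.Γ q (slice w.1 k.1) (slice w.2.1 k.1) (slice w.2.2.2 k.1)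
      (slice w.2.2.1 k.1)) k.2
    have h6 : ‖(F.innerMap q w - F.innerMap ⊤ w) k‖ = |(F.Γ ⊤ (slice w.1 k.1) (slice w.2.1 k.1)
        (slice w.2.2.2 k.1) (slice w.2.2.1 k.1) - F.Γ q (slice w.1 k.1) (slice w.2.1 k.1)
        (slice w.2.2.2 k.1) (slice w.2.2.1 k.1)) k.2| := by
      rw [Real.norm_eq_abs, Pi.sub_apply, Pi.sub_apply, abs_sub_comm]; rfl
    rw [h6]
    calc _ ≤ _ := h5.trans h3
      _ ≤ n * (L * ‖w - w₀‖) * f q := by gcongr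
      _ = _ := by ring
  refine IsBigO.of_bound (n * L) ?_
  filter_upwards [eventually_ge_atTop 1] with q hq
  have hq' : (1 : ℕ∞) ≤ q := by exact_mod_cast hq
  have hfq := hf.nonneg q
  have hd := (hreg.differentiableAt_innerMap q hq').hasFDerivAt.sub hdtop.hasFDerivAt
  rw [Real.norm_of_nonneg hfq]
  refine hd.le_of_lip' (by positivity) ?_
  filter_upwards [key] with w hw
  simp only [Pi.sub_apply]
  rw [htruth.innerMap_eq hfix q hq', htruth.innerMap_eq hfix ⊤ le_top, sub_self, sub_zero]
  exact hw q hq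

/-! ### The M-step criterion -/

/-- The M-step criterion as a function of the solution `Y` of the inner problem. -/
noncomputable def outerCrit (F : Framework d n J M T X A) (s : State d n J M X A)
    (z : (Fin M × Fin d → ℝ) × (Fin M × CcpIdx J X A → ℝ) × (Fin M → ℝ) × (Fin M × Fin n → ℝ)) :
    ℝ :=
  ∑ m, ∑ ω, F.law s ω * (posterior ω m z.2.1 z.2.2.1 *
    ∑ t, ∑ j, Real.log (F.stackedΛ z.1 z.2.2.2 z.2.1 (m, (j, (ω t).1, (ω t).2 j))))

/-- The M-step score as a function of `(θ, P, π)` and the solution `Y` of the inner problem. -/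
noncomputable def outerScore (F : Framework d n J M T X A) (s : State d n J M X A)
    (z : ((Fin M × Fin d → ℝ) × (Fin M × CcpIdx J X A → ℝ) × (Fin M → ℝ)) × (Fin M × Fin n → ℝ)) :
    Fin M × Fin d → ℝ :=
  grad (fun ϑ => F.outerCrit s (ϑ, z.1.2.1, z.1.2.2, z.2)) z.1.1

theorem IsTruth.P_pos (htruth : F.IsTruth s) (i : Fin M × CcpIdx J X A) : 0 < s.P i := by
  rw [htruth.P_eq]; exact Λ_pos _ _ _ _

theorem IsRegular.contDiffAt_stackedΛ [DecidableEq X] [DecidableEq A] (hreg : F.IsRegular s) :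
    ContDiffAt ℝ 3 (fun z : (Fin M × Fin d → ℝ) × (Fin M × Fin n → ℝ) ×
      (Fin M × CcpIdx J X A → ℝ) => F.stackedΛ z.1 z.2.1 z.2.2) (s.θ, s.Y, s.P) := by
  refine contDiffAt_pi.2 fun k => ?_
  have h2 : ContDiffAt ℝ 3 (fun z : (Fin M × Fin d → ℝ) × (Fin M × Fin n → ℝ) ×
      (Fin M × CcpIdx J X A → ℝ) => (sliceL k.1 z.1, sliceL k.1 z.2.1, sliceL k.1 z.2.2))
      (s.θ, s.Y, s.P) := by fun_prop
  exact contDiffAt_pi.1 (ContDiffAt.comp (s.θ, s.Y, s.P) (hreg.smooth_Λ k.1) h2) k.2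

/-- A quotient of polynomials whose denominator is positive at the truth: the weights are positive,
and so is `P*`, being a value of the logit map. -/
theorem contDiffAt_posterior (htruth : F.IsTruth s) (ω : Panel T J X A) (m : Fin M) :
    ContDiffAt ℝ 3 (fun z : (Fin M × CcpIdx J X A → ℝ) × (Fin M → ℝ) => posterior ω m z.1 z.2)
      (s.P, s.π) := by
  have hlik : ∀ m, ContDiffAt ℝ 3 (fun z : (Fin M × CcpIdx J X A → ℝ) × (Fin M → ℝ) =>
      z.2 m * ∏ t, ∏ j, z.1 (m, (j, (ω t).1, (ω t).2 j))) (s.P, s.π) := fun m =>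
    ContDiffAt.mul (by fun_prop) (contDiffAt_prod fun t _ => contDiffAt_prod fun j _ => by fun_prop)
  refine (hlik m).div (ContDiffAt.sum fun m' _ => hlik m') (ne_of_gt ?_)
  exact Finset.sum_pos (fun m' _ => mul_pos (htruth.π_pos m')
    (Finset.prod_pos fun t _ => Finset.prod_pos fun j _ => htruth.P_pos _)) ⟨m, Finset.mem_univ m⟩

/-- For `ϑ` near an interior point the inner solution is constant in `ϑ`, so it may be frozen before
the gradient is taken. The score is thus a `q`-free function of the value of `Γ^q`. Interiority
matters because separability is only known on `Θ`. -/
theorem mScore_eq_outerScore (hsep : F.ThetaSeparable) (q : ℕ∞) {w : InnerArg d n J M X A}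
    (hw : F.IsInterior w) (π : Fin M → ℝ) :
    F.mScore s q w.1 w.2.1 w.2.2.1 w.2.2.2 π =
      F.outerScore s ((w.1, w.2.2.2, π), F.innerMap q w) := by
  have heq : (fun ϑ => F.mCrit s q ϑ w.2.1 w.2.2.1 w.2.2.2 π) =ᶠ[𝓝 w.1]
      fun ϑ => F.outerCrit s (ϑ, w.2.2.2, π, F.innerMap q w) := by
    filter_upwards [eventually_slice_mem hw.θ] with ϑ hϑ
    have := stackedΓ_congr hsep q (fun m => interior_subset (hϑ m))
      (fun m => interior_subset (hw.θ m)) (fun m => interior_subset (hw.θ' m))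
      (fun m => interior_subset (hw.P m)) w.2.2.1
    simp only [mCrit, outerCrit, stackedΛq, this, innerMap]
  funext k
  simp only [mScore, outerScore, grad, heq.fderiv_eq]

variable [DecidableEq X] [DecidableEq A]

theorem contDiffAt_outerCrit (htruth : F.IsTruth s) (hreg : F.IsRegular s) :
    ContDiffAt ℝ 3 (F.outerCrit s) (s.θ, s.P, s.π, s.Y) := by
  unfold outerCrit
  refine ContDiffAt.sum fun m _ => ContDiffAt.sum fun ω _ => contDiffAt_const.mul
    (ContDiffAt.mul ?_ (ContDiffAt.sum fun t _ => ContDiffAt.sum fun j _ => ContDiffAt.log ?_ ?_))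
  · exact ContDiffAt.comp (f := fun z : (Fin M × Fin d → ℝ) × (Fin M × CcpIdx J X A → ℝ) ×
      (Fin M → ℝ) × (Fin M × Fin n → ℝ) => (z.2.1, z.2.2.1)) (s.θ, s.P, s.π, s.Y)
      (contDiffAt_posterior htruth ω m) (by fun_prop)
  · exact contDiffAt_pi.1 (ContDiffAt.comp (f := fun z : (Fin M × Fin d → ℝ) ×
      (Fin M × CcpIdx J X A → ℝ) × (Fin M → ℝ) × (Fin M × Fin n → ℝ) => (z.1, z.2.2.2, z.2.1))
      (s.θ, s.P, s.π, s.Y) hreg.contDiffAt_stackedΛ (by fun_prop)) _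
  · exact (Λ_pos _ _ _ _).ne'

theorem differentiableAt_outerScore (htruth : F.IsTruth s) (hreg : F.IsRegular s) :
    DifferentiableAt ℝ (F.outerScore s) ((s.θ, s.P, s.π), s.Y) := by
  have h1 : ContDiffAt ℝ 1 (fun z : ((Fin M × Fin d → ℝ) × (Fin M × CcpIdx J X A → ℝ) ×
      (Fin M → ℝ)) × (Fin M × Fin n → ℝ) =>
      fderiv ℝ (fun ϑ => F.outerCrit s (ϑ, z.1.2.1, z.1.2.2, z.2)) z.1.1)
      ((s.θ, s.P, s.π), s.Y) := by
    -- The gradient in `ϑ` costs one derivative and differentiability of the score another, so `C³`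
    -- is more than enough.
    refine ContDiffAt.fderiv (n := 3) (f := fun (z : ((Fin M × Fin d → ℝ) ×
      (Fin M × CcpIdx J X A → ℝ) × (Fin M → ℝ)) × (Fin M × Fin n → ℝ)) ϑ =>
      F.outerCrit s (ϑ, z.1.2.1, z.1.2.2, z.2)) (g := fun z => z.1.1) ?_ (by fun_prop) (by norm_num)
    exact ContDiffAt.comp (g := F.outerCrit s) (f := fun y : (((Fin M × Fin d → ℝ) ×
      (Fin M × CcpIdx J X A → ℝ) × (Fin M → ℝ)) × (Fin M × Fin n → ℝ)) × (Fin M × Fin d → ℝ) =>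
      (y.2, y.1.1.2.1, y.1.1.2.2, y.1.2)) (((s.θ, s.P, s.π), s.Y), s.θ)
      (contDiffAt_outerCrit htruth hreg) (by fun_prop)
  refine differentiableAt_pi.2 fun k => ?_
  exact (h1.differentiableAt (by norm_num)).clm_apply (differentiableAt_const _)


/-! ### Convergence of the rate matrices -/

variable {d n J M T : ℕ} {X A : Type*} [Fintype X] [Fintype A]
  {F : Framework d n J M T X A} {s : State d n J M X A}

/-- The M-step Hessian does not depend on the number of inner steps. -/
theorem mHess_eq_mHess_top (hsep : F.ThetaSeparable) (hfix : F.SameFixedPoint)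
    (htruth : F.IsTruth s) (q : ℕ∞) (hq : 1 ≤ q) : F.mHess s q = F.mHess s ⊤ := by
  -- With `θ'`, `Y`, `P` at the truth, moving `θ` leaves the inner solution at `Y*`, so near `θ*`
  -- the scores for all `r ≥ 1` are one and the same function.
  have key : ∀ r : ℕ∞, 1 ≤ r → (fun θ => F.mScore s r θ s.θ s.Y s.P s.π) =ᶠ[𝓝 s.θ]
      fun θ => F.outerScore s ((θ, s.P, s.π), s.Y) := by
    intro r hr
    filter_upwards [eventually_slice_mem htruth.θ_interior] with θ hθ
    rw [mScore_eq_outerScore hsep r (w := (θ, s.θ, s.Y, s.P))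
      ⟨hθ, htruth.θ_interior, htruth.Y_interior, htruth.P_interior⟩ s.π]
    have : F.innerMap r (θ, s.θ, s.Y, s.P) = s.Y :=
      stackedΓ_eq_self hsep (fun m => interior_subset (hθ m))
        (fun m => interior_subset (htruth.θ_interior m))
        (fun m => interior_subset (htruth.P_interior m)) (htruth.innerMap_eq hfix r hr)
    rw [this]
  simp only [mHess, jacobian, ((key q hq).trans (key ⊤ le_top).symm).fderiv_eq]

variable [DecidableEq X] [DecidableEq A]

section

variable {f : ℕ → ℝ} {κ : Type*} [Fintype κ] [DecidableEq κ] {e : κ → ℝ}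
  {u : (κ → ℝ) → InnerArg d n J M X A}

theorem convergesAtRate_jacobian_Γ (hfix : F.SameFixedPoint) (htruth : F.IsTruth s)
    (hreg : F.IsRegular s) (hf : F.IsErrorBound s f) (hu : DifferentiableAt ℝ u e)
    (hue : u e = innerArg s) :
    ConvergesAtRate f fun q => jacobian
      (fun x => F.stackedΓ q (u x).1 (u x).2.1 (u x).2.2.1 (u x).2.2.2) e :=
  ConvergesAtRate.jacobian_comp hreg.differentiableAt_innerMap (htruth.innerMap_eq hfix)
    (hf.isBigO_fderiv_innerMap hfix htruth hreg) (Ψ := fun z : ℝ × (Fin M × Fin n → ℝ) => z.2)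
    (z₀ := 0) (by fun_prop) (c := fun _ => 0) (by fun_prop) rfl hu hue fun _ _ => EventuallyEq.rfl

theorem convergesAtRate_jacobian_Λq (hfix : F.SameFixedPoint) (htruth : F.IsTruth s)
    (hreg : F.IsRegular s) (hf : F.IsErrorBound s f) (hu : DifferentiableAt ℝ u e)
    (hue : u e = innerArg s) :
    ConvergesAtRate f fun q => jacobian
      (fun x => F.stackedΛq q (u x).1 (u x).2.1 (u x).2.2.1 (u x).2.2.2) e := by
  refine ConvergesAtRate.jacobian_comp hreg.differentiableAt_innerMap (htruth.innerMap_eq hfix)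
    (hf.isBigO_fderiv_innerMap hfix htruth hreg)
    (Ψ := fun z : ((Fin M × Fin d → ℝ) × (Fin M × CcpIdx J X A → ℝ)) × (Fin M × Fin n → ℝ) =>
      F.stackedΛ z.1.1 z.2 z.1.2)
    (z₀ := (s.θ, s.P)) ?_ (c := fun x => ((u x).1, (u x).2.2.2)) (by fun_prop)
    (by rw [hue]; rfl) hu hue fun _ _ => EventuallyEq.rfl
  exact DifferentiableAt.comp (f := fun z : ((Fin M × Fin d → ℝ) ×
    (Fin M × CcpIdx J X A → ℝ)) × (Fin M × Fin n → ℝ) => (z.1.1, z.2, z.1.2)) ((s.θ, s.P), s.Y)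
    (hreg.contDiffAt_stackedΛ.differentiableAt (by norm_num)) (by fun_prop)

theorem convergesAtRate_jacobian_mScore (hsep : F.ThetaSeparable) (hfix : F.SameFixedPoint)
    (htruth : F.IsTruth s) (hreg : F.IsRegular s) (hf : F.IsErrorBound s f)
    (hu : DifferentiableAt ℝ u e) (hue : u e = innerArg s) {p : (κ → ℝ) → Fin M → ℝ}
    (hp : DifferentiableAt ℝ p e) (hpe : p e = s.π) :
    ConvergesAtRate f fun q => jacobian
      (fun x => F.mScore s q (u x).1 (u x).2.1 (u x).2.2.1 (u x).2.2.2 (p x)) e := by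
  refine ConvergesAtRate.jacobian_comp hreg.differentiableAt_innerMap (htruth.innerMap_eq hfix)
    (hf.isBigO_fderiv_innerMap hfix htruth hreg) (differentiableAt_outerScore htruth hreg)
    (c := fun x => ((u x).1, (u x).2.2.2, p x)) (by fun_prop) (by rw [hue, hpe]; rfl) hu hue
    fun q _ => ?_
  have hev : ∀ᶠ x in 𝓝 e, F.IsInterior (u x) :=
    hu.continuousAt.eventually (hue.symm ▸ htruth.isInterior.eventually)
  filter_upwards [hev] with x hx using mScore_eq_outerScore hsep q hx (p x)

end

/-- The rate matrices of EM-NPL(`q`) approach the one of EM-NPL at the rate of the inner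
algorithm. -/
theorem convergesAtRate_rateMatrix {f : ℕ → ℝ} (hsep : F.ThetaSeparable)
    (hfix : F.SameFixedPoint) (htruth : F.IsTruth s) (hreg : F.IsRegular s)
    (hf : F.IsErrorBound s f) : ConvergesAtRate f fun q => F.rateMatrix s q := by
  have h0 := hf.tendsto_zero
  have hΓθ := convergesAtRate_jacobian_Γ hfix htruth hreg hf (e := s.θ)
    (u := fun θ => (θ, s.θ, s.Y, s.P)) (by fun_prop) rfl
  have hΓθ' := convergesAtRate_jacobian_Γ hfix htruth hreg hf (e := s.θ)
    (u := fun θ' => (s.θ, θ', s.Y, s.P)) (by fun_prop) rfl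
  have hΓY := convergesAtRate_jacobian_Γ hfix htruth hreg hf (e := s.Y)
    (u := fun Y => (s.θ, s.θ, Y, s.P)) (by fun_prop) rfl
  have hΓP := convergesAtRate_jacobian_Γ hfix htruth hreg hf (e := s.P)
    (u := fun P => (s.θ, s.θ, s.Y, P)) (by fun_prop) rfl
  have hΛθ := convergesAtRate_jacobian_Λq hfix htruth hreg hf (e := s.θ)
    (u := fun θ => (θ, s.θ, s.Y, s.P)) (by fun_prop) rfl
  have hΛθ' := convergesAtRate_jacobian_Λq hfix htruth hreg hf (e := s.θ)
    (u := fun θ' => (s.θ, θ', s.Y, s.P)) (by fun_prop) rfl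
  have hΛY := convergesAtRate_jacobian_Λq hfix htruth hreg hf (e := s.Y)
    (u := fun Y => (s.θ, s.θ, Y, s.P)) (by fun_prop) rfl
  have hΛP := convergesAtRate_jacobian_Λq hfix htruth hreg hf (e := s.P)
    (u := fun P => (s.θ, s.θ, s.Y, P)) (by fun_prop) rfl
  have hSπ := convergesAtRate_jacobian_mScore hsep hfix htruth hreg hf (e := s.π)
    (u := fun _ => (s.θ, s.θ, s.Y, s.P)) (by fun_prop) rfl (p := fun π => π) (by fun_prop) rfl
  have hSθ' := convergesAtRate_jacobian_mScore hsep hfix htruth hreg hf (e := s.θ)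
    (u := fun θ' => (s.θ, θ', s.Y, s.P)) (by fun_prop) rfl (p := fun _ => s.π) (by fun_prop) rfl
  have hSY := convergesAtRate_jacobian_mScore hsep hfix htruth hreg hf (e := s.Y)
    (u := fun Y => (s.θ, s.θ, Y, s.P)) (by fun_prop) rfl (p := fun _ => s.π) (by fun_prop) rfl
  have hSP := convergesAtRate_jacobian_mScore hsep hfix htruth hreg hf (e := s.P)
    (u := fun P => (s.θ, s.θ, s.Y, P)) (by fun_prop) rfl (p := fun _ => s.π) (by fun_prop) rfl
  -- The Hessian is constant in `q ≥ 1`, so no perturbation estimate for matrix inversion is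
  -- required.
  have hinv : ConvergesAtRate f fun q => (F.mHess s q)⁻¹ := ConvergesAtRate.of_eq fun q hq => by
    rw [mHess_eq_mHess_top hsep hfix htruth q hq]
  have hHπ : ConvergesAtRate f fun q => F.Hπ s q := (hinv.mul h0 hSπ).neg
  have hHθ' : ConvergesAtRate f fun q => F.Hθ' s q := (hinv.mul h0 hSθ').neg
  have hHY : ConvergesAtRate f fun q => F.HY s q := (hinv.mul h0 hSY).neg
  have hHP : ConvergesAtRate f fun q => F.HP s q := (hinv.mul h0 hSP).neg
  refine ConvergesAtRate.fromRows (ConvergesAtRate.of_eq fun _ _ => rfl) (ConvergesAtRate.fromRows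
    (hHπ.fromCols (hHθ'.fromCols (hHY.fromCols hHP))) (ConvergesAtRate.fromRows ?_ ?_))
  · exact (hΓθ.mul h0 hHπ).fromCols (((hΓθ.mul h0 hHθ').add hΓθ').fromCols
      (((hΓθ.mul h0 hHY).add hΓY).fromCols ((hΓθ.mul h0 hHP).add hΓP)))
  · exact (hΛθ.mul h0 hHπ).fromCols (((hΛθ.mul h0 hHθ').add hΛθ').fromCols
      (((hΛθ.mul h0 hHY).add hΛY).fromCols ((hΛθ.mul h0 hHP).add hΛP)))

end Framework

/-! ### From spectral radii to iteration counts -/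

/-- The bounds for `log a / log ρ` that follow from `|ρ - ρ₀| ≤ g`. -/
theorem div_log_mem_Icc {a ρ ρ₀ g : ℝ} (ha : a ≤ 0) (hρ₀ : 0 < ρ₀) (h1 : 0 < ρ₀ - g)
    (h2 : ρ₀ + g < 1) (hρ : |ρ - ρ₀| ≤ g) :
    a / Real.log ρ ∈ Set.Icc (a / Real.log ρ₀ * (Real.log ρ₀ / Real.log (ρ₀ - g)))
      (a / Real.log ρ₀ * (Real.log ρ₀ / Real.log (ρ₀ + g))) := by
  obtain ⟨h3, h4⟩ := abs_le.1 hρ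
  have hg : 0 ≤ g := (abs_nonneg _).trans hρ
  have hlog : Real.log ρ₀ ≠ 0 := (Real.log_neg hρ₀ (by linarith)).ne
  rw [div_mul_div_cancel₀ hlog, div_mul_div_cancel₀ hlog]
  -- With `a ≤ 0` and negative logarithms, `a / log x = (-a) / (-log x)`, whose denominator
  -- decreases in `x` on `(0, 1)`.
  have hmono : ∀ x y : ℝ, 0 < x → x ≤ y → y < 1 → a / Real.log x ≤ a / Real.log y := by
    intro x y hx hxy hy
    have hly := Real.log_neg (hx.trans_le hxy) hy
    rw [← neg_div_neg_eq a (Real.log x), ← neg_div_neg_eq a (Real.log y)]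
    exact div_le_div_of_nonneg_left (neg_nonneg.2 ha) (neg_pos.2 hly)
      (neg_le_neg (Real.log_le_log hx hxy))
  exact ⟨hmono _ _ h1 (by linarith) (by linarith), hmono _ _ (by linarith) (by linarith) h2⟩

end EMNPL

theorem mainTheorem6 {d n J M T : ℕ} {X A : Type*} [Fintype X] [Fintype A]
    [DecidableEq X] [DecidableEq A]
    (F : EMNPL.Framework d n J M T X A) (s : EMNPL.State d n J M X A) (f : ℕ → ℝ)
    (hsep : F.ThetaSeparable) (hfix : F.SameFixedPoint) (htruth : F.IsTruth s)
    (hreg : F.IsRegular s) (hf : F.IsErrorBound s f) :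
    -- EM-NPL(q) and EM-NPL share their estimators
    (∀ q : ℕ, 1 ≤ q → ∀ (N : ℕ) (data : Fin N → EMNPL.Panel T J X A)
      (x : EMNPL.State d n J M X A), F.IsEstimator q data x ↔ F.IsEstimator ⊤ data x) ∧
    ∃ C : ℝ, 0 < C ∧ ∃ g : ℕ → ℝ,
      (∀ q, g q =
        C * f q ^ (1 / (EMNPL.largestJordanBlock (F.rateMatrix s ⊤) : ℝ))) ∧
      (∀ᶠ q : ℕ in atTop,
        |EMNPL.specRadius (F.rateMatrix s q) - EMNPL.specRadius (F.rateMatrix s ⊤)| ≤ g q) ∧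
      (0 < EMNPL.specRadius (F.rateMatrix s ⊤) → EMNPL.specRadius (F.rateMatrix s ⊤) < 1 →
        ∀ᶠ q : ℕ in atTop,
          0 < EMNPL.specRadius (F.rateMatrix s q) ∧ EMNPL.specRadius (F.rateMatrix s q) < 1 ∧
          0 < EMNPL.specRadius (F.rateMatrix s ⊤) - g q ∧
          EMNPL.specRadius (F.rateMatrix s ⊤) + g q < 1 ∧
          ∀ (N : ℕ) (data : Fin N → EMNPL.Panel T J X A) (x₀ xstar : EMNPL.State d n J M X A)
            (ε : ℝ), F.IsEstimator ⊤ data xstar → 0 < ε →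
            ε < EMNPL.l2norm (x₀.vec - xstar.vec) →
            F.iterBound s q ε x₀ xstar ∈ Set.Icc
              (F.iterBound s ⊤ ε x₀ xstar *
                (Real.log (EMNPL.specRadius (F.rateMatrix s ⊤)) /
                  Real.log (EMNPL.specRadius (F.rateMatrix s ⊤) - g q)))
              (F.iterBound s ⊤ ε x₀ xstar *
                (Real.log (EMNPL.specRadius (F.rateMatrix s ⊤)) /
                  Real.log (EMNPL.specRadius (F.rateMatrix s ⊤) + g q)))) := by
  refine ⟨fun q hq N data x => ⟨fun h => h.change hsep hfix (by exact_mod_cast hq) le_top,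
    fun h => h.change hsep hfix le_top (by exact_mod_cast hq)⟩, ?_⟩
  -- The type probabilities sum to one, so there is at least one type; hence the rate matrices are
  -- not empty and have eigenvalues.
  have : Nonempty (EMNPL.StateIdx d n J M X A) := by
    by_contra h
    rw [not_nonempty_iff] at h
    have hM : IsEmpty (Fin M) := ⟨fun m => h.false (Sum.inl m)⟩
    simpa using htruth.π_sum
  obtain ⟨C, hC, hρ⟩ := EMNPL.exists_eventually_abs_specRadius_sub_le hf.nonneg hf.tendsto_zero
    (R := fun q => F.rateMatrix s q) (R₀ := F.rateMatrix s ⊤)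
    (EMNPL.Framework.convergesAtRate_rateMatrix hsep hfix htruth hreg hf)
  set ν := EMNPL.largestJordanBlock (F.rateMatrix s ⊤) with hν
  have hg : Tendsto (fun q => C * f q ^ (1 / (ν : ℝ))) atTop (𝓝 0) := by
    have hk : (0 : ℝ) < 1 / (ν : ℝ) := by
      have := Nat.pos_of_ne_zero (EMNPL.largestJordanBlock_ne_zero (F.rateMatrix s ⊤))
      positivity
    have := (hf.tendsto_zero.rpow_const (p := 1 / (ν : ℝ)) (Or.inr hk.le)).const_mul C
    rwa [Real.zero_rpow hk.ne', mul_zero] at this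
  refine ⟨C, hC, fun q => C * f q ^ (1 / (ν : ℝ)), fun _ => rfl, hρ, fun hpos hlt => ?_⟩
  -- Eventually `g q < ρ(R^∞)` and `g q < 1 - ρ(R^∞)`, which keeps both endpoints `ρ(R^∞) ± g q`,
  -- and `ρ(R^q)` between them, inside `(0, 1)`.
  filter_upwards [hρ, hg.eventually (gt_mem_nhds hpos),
    hg.eventually (gt_mem_nhds (sub_pos.2 hlt))] with q hq h1 h2
  obtain ⟨h3, h4⟩ := abs_le.1 hq
  refine ⟨by linarith, by linarith, by linarith, by linarith,
    fun N data x₀ xstar ε _ hε hlt' => ?_⟩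
  have ha : Real.log ε - Real.log (EMNPL.l2norm (x₀.vec - xstar.vec)) ≤ 0 :=
    sub_nonpos.2 (Real.log_le_log hε hlt'.le)
  exact EMNPL.div_log_mem_Icc ha hpos (by linarith) (by linarith) hq
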